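/- Let $k$ be a field and let $\Lambda$ be a finite dimensional $k$-algebra of global dimension $d$ with $2\le d<\infty$. Let $2\le l\le d$. Write $\mathrm{mod}\,\Lambda$ for the category of finitely generated left $\Lambda$-modules, and $\mathrm{add}\,\mathcal S$ for the full subcategory of direct summands of finite direct sums of objects of $\mathcal S$. Consider the full subcategory $$\mathcal U^{(l)}=\mathrm{add}\{A[il] \mid A\in \mathrm{mod}\,\Lambda,\ i\in\mathbb Z\}$$ of the bounded derived category $D^b(\mathrm{mod}\,\Lambda)$. For a preadditive category $\mathcal C$, let $\mathrm{Mod}\,\mathcal C$ be the abelian category of contravariant additive functors from $\mathcal C$ to abelian groups, and $\mathrm{mod}\,\mathcal C$ its full subcategory of finitely presented objects, i.e. those $X$ with an exact sequence $\mathcal C(-,B)\to\mathcal C(-,A)\to X\to 0$ with $A,B\in\mathcal C$. The category $\mathcal C$ is coherent if it has weak kernels and weak cokernels. Its left (resp. right) global dimension is the supremum of all $n$ such that $\mathrm{Ext}^n$, computed in $\mathrm{Mod}\,\mathcal C$ (resp. $\mathrm{Mod}\,\mathcal C^{\mathrm{op}}$), does not vanish identically on $\mathrm{mod}\,\mathcal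 C$ (resp. $\mathrm{mod}\,\mathcal C^{\mathrm{op}}$). (1) The category $\mathcal U^{(l)}$ is coherent, and its left and right global dimensions are at most $3d-1$. (2) If $M\in\mathrm{mod}\,\Lambda$ is an additive generator, i.e. $\mathrm{add}\,M=\mathrm{mod}\,\Lambda$ (so that $\Lambda$ is of finite representation type), then the Veronese subalgebra $$\Gamma^{(l)}=\bigoplus_{i\ge 0}\mathrm{Ext}_\Lambda^{il}(M,M)$$ of the Yoneda algebra of $M$, with the Yoneda product, has left and right global dimension at most $3d-1$. -/

import Mathlib

open CategoryTheory Limits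

universe w v u t

/-! ### Modules over a preadditive category, coherence, global dimension -/

section FunctorCategories

section Abelian

open ZeroObject

variable (C : Type u) [Category.{v} C] [Preadditive C]

instance additiveFunctor_containsZero :
    (additiveFunctor C AddCommGrpCat.{w}).ContainsZero where
  exists_zero := ⟨0, isZero_zero _, (inferInstance : (0 : C ⥤ AddCommGrpCat.{w}).Additive)⟩

instance additiveFunctor_isClosedUnderSubobjects :
    (additiveFunctor C AddCommGrpCat.{w}).IsClosedUnderSubobjects where
  prop_of_mono {F G} f _ h := by
    have := (additiveFunctor_iff _).1 h
    refine ⟨fun {X Y a b} => ?_⟩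
    rw [← cancel_mono (f.app Y)]
    simp [Preadditive.add_comp, Preadditive.comp_add]

instance additiveFunctor_isClosedUnderQuotients :
    (additiveFunctor C AddCommGrpCat.{w}).IsClosedUnderQuotients where
  prop_of_epi {F G} f _ h := by
    have := (additiveFunctor_iff _).1 h
    refine ⟨fun {X Y a b} => ?_⟩
    rw [← cancel_epi (f.app X)]
    simp only [Preadditive.comp_add, ← f.naturality, Functor.map_add, Preadditive.add_comp]

instance additiveFunctor_isClosedUnderFiniteProducts :
    (additiveFunctor C AddCommGrpCat.{w}).IsClosedUnderFiniteProducts where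
  isClosedUnderLimitsOfShape J _ := ⟨by
    rintro F ⟨p⟩
    have := fun j => (additiveFunctor_iff _).1 (p.prop_diag_obj j)
    refine ⟨fun {X Y a b} => ?_⟩
    refine (isLimitOfPreserves ((evaluation C AddCommGrpCat.{w}).obj Y) p.isLimit).hom_ext
      fun j => ?_
    have h := fun (a : X ⟶ Y) => (p.π.app j).naturality a
    dsimp at h ⊢
    simp only [Preadditive.add_comp, h, Functor.map_add, Preadditive.comp_add]⟩

end Abelian

variable (C : Type u) [Category.{v} C] [Preadditive C]

/-- The category `Mod C` of modules over a preadditive category `C`: contravariant additive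
functors from `C` to abelian groups.  It is abelian, as a full subcategory of the category of all
functors closed under finite products, kernels and cokernels. -/
abbrev CatMod : Type _ := Cᵒᵖ ⥤+ AddCommGrpCat.{v}

variable {C}

/-- The representable module `C(-, A)`. -/
def reprMod (A : C) : CatMod C := AdditiveFunctor.of (preadditiveYoneda.obj A)

/-- A module `X` is finitely presented if there is an exact sequence
`C(-, B) ⟶ C(-, A) ⟶ X ⟶ 0`. -/
def IsFinPresMod (X : CatMod C) : Prop :=
  ∃ (A B : C) (f : reprMod B ⟶ reprMod A) (p : reprMod A ⟶ X) (hfp : f ≫ p = 0),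
    (ShortComplex.mk f p hfp).Exact ∧ Epi p

variable (C)

/-- A category is left coherent if it has weak kernels, right coherent if it has weak cokernels,
and coherent if it is both. -/
def IsCoherentCat : Prop := HasWeakKernels C ∧ HasWeakKernels Cᵒᵖ

/-- The left global dimension of `C`: the supremum of all `n` such that `Ext^n`, computed in the
abelian category `Mod C`, does not vanish on the category `mod C` of finitely presented modules.
It is `⊤` if there are arbitrarily large such `n` (and `⊥` if all modules are zero). -/
noncomputable def leftGlobalDim : WithBot ℕ∞ :=
  letI := HasExt.standard (CatMod C)
  sSup {e : WithBot ℕ∞ | ∃ (n : ℕ) (X Y : CatMod C), e = n ∧ IsFinPresMod X ∧ IsFinPresMod Y ∧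
    Nontrivial (Abelian.Ext X Y n)}

/-- The right global dimension of `C`: the same with `mod Cᵒᵖ` (covariant functors on `C`). -/
noncomputable def rightGlobalDim : WithBot ℕ∞ := leftGlobalDim Cᵒᵖ

end FunctorCategories

/-- The (left) global dimension of a ring: the supremum of the projective dimensions of all its
left modules. -/
noncomputable def ringGlobalDim (R : Type u) [Ring R] : WithBot ℕ∞ :=
  ⨆ X : ModuleCat.{u} R, projectiveDimension X

/-- `add P`: the direct summands of finite direct sums of objects satisfying `P`. -/
def addClosure {C : Type u} [Category.{v} C] [Preadditive C] (P : ObjectProperty C) :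
    ObjectProperty C :=
  fun X => ∃ (n : ℕ) (Y : Fin n → C) (b : Bicone Y),
    (∀ j, P (Y j)) ∧ Nonempty b.IsBilimit ∧ Nonempty (Retract X b.pt)

/-- `M` is an additive generator of `C` if `C = add M`. -/
def IsAdditiveGenerator {C : Type u} [Category.{v} C] [Preadditive C] (M : C) : Prop :=
  ∀ X : C, addClosure (fun Y => Y = M) X

/-! ### Finitely generated modules over a finite-dimensional algebra -/

section FinMod

variable (k : Type t) (Λ : Type u) [Field k] [Ring Λ] [Algebra k Λ] [FiniteDimensional k Λ]

/-- The property of being a finitely generated left `Λ`-module.  (The ground field is recorded so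
that the instances below can use that `Λ` is finite-dimensional.) -/
def isFinMod (k : Type t) (Λ : Type u) [Field k] [Ring Λ] [Algebra k Λ] [FiniteDimensional k Λ] :
    ObjectProperty (ModuleCat.{u} Λ) := fun M => Module.Finite Λ M

/-- The category `mod Λ` of finitely generated left modules over a finite-dimensional
`k`-algebra `Λ`. -/
abbrev FinMod : Type _ := (isFinMod k Λ).FullSubcategory

instance isFinMod_containsZero : (isFinMod k Λ).ContainsZero where
  exists_zero := ⟨ModuleCat.of Λ PUnit, ModuleCat.isZero_of_subsingleton _,
    (inferInstance : Module.Finite Λ PUnit.{u + 1})⟩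

instance isFinMod_isClosedUnderSubobjects : (isFinMod k Λ).IsClosedUnderSubobjects where
  prop_of_mono {_ Y} f _ h := by
    have : Module.Finite Λ Y := h
    have : IsNoetherianRing Λ := isNoetherian_of_tower k inferInstance
    exact Module.Finite.of_injective f.hom ((ModuleCat.mono_iff_injective f).1 inferInstance)

instance isFinMod_isClosedUnderQuotients : (isFinMod k Λ).IsClosedUnderQuotients where
  prop_of_epi {X _} f _ h := by
    have : Module.Finite Λ X := h
    exact Module.Finite.of_surjective f.hom ((ModuleCat.epi_iff_surjective f).1 inferInstance)

instance isFinMod_isClosedUnderFiniteProducts :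
    (isFinMod k Λ).IsClosedUnderFiniteProducts where
  isClosedUnderLimitsOfShape J _ := ⟨by
    rintro X ⟨p⟩
    have : Fintype J := Fintype.ofFinite J
    have h : ∀ j, Module.Finite Λ (p.diag.obj ⟨j⟩) := fun j => p.prop_diag_obj ⟨j⟩
    have : Module.Finite Λ (∀ j : J, p.diag.obj ⟨j⟩) := inferInstance
    have : IsNoetherianRing Λ := isNoetherian_of_tower k inferInstance
    refine Module.Finite.of_injective
      (LinearMap.pi fun j => (p.π.app ⟨j⟩).hom : X →ₗ[Λ] (∀ j : J, p.diag.obj ⟨j⟩)) ?_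
    intro x y hxy
    refine Concrete.isLimit_ext _ p.isLimit x y ?_
    rintro ⟨j⟩
    exact congrFun hxy j⟩

instance finMod_enoughProjectives : EnoughProjectives (FinMod k Λ) where
  presentation X := by
    have hX : Module.Finite Λ X.obj := X.property
    obtain ⟨n, f, hf⟩ := Module.Finite.exists_fin' Λ X.obj
    have : (isFinMod k Λ).ι.PreservesEpimorphisms :=
      (isFinMod k Λ).preservesEpimorphisms_ι_of_isNormalMonoCategory
    have hP : Projective (ModuleCat.of Λ (Fin n → Λ)) :=
      ModuleCat.projective_of_free (Pi.basisFun Λ (Fin n))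
    let P : FinMod k Λ := ⟨ModuleCat.of Λ (Fin n → Λ),
      (inferInstance : Module.Finite Λ (Fin n → Λ))⟩
    have hP' : Projective P := by
      refine ⟨fun {E Y} g e _ => ?_⟩
      have : Epi e.hom := inferInstanceAs (Epi ((isFinMod k Λ).ι.map e))
      obtain ⟨q, hq⟩ := hP.factors g.hom e.hom
      exact ⟨ObjectProperty.homMk q, ObjectProperty.hom_ext _ hq⟩
    let p : P ⟶ X := ObjectProperty.homMk (ModuleCat.ofHom f)
    have hp : Epi p := by
      apply (isFinMod k Λ).ι.epi_of_epi_map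
      exact (ModuleCat.epi_iff_surjective _).2 hf
    exact ⟨⟨P, p⟩⟩

instance finMod_hasExt : HasExt.{u} (FinMod k Λ) :=
  hasExt_of_enoughProjectives _

end FinMod

/-! ### The Veronese subcategory of the Yoneda category -/

section VeroneseCat

variable (k : Type t) (Λ : Type u) [Field k] [Ring Λ] [Algebra k Λ] [FiniteDimensional k Λ]
  [HasDerivedCategory.{w} (FinMod k Λ)]

/-- A module, regarded as an object of `D^b(mod Λ)` concentrated in degree `0`. -/
noncomputable def stalk (A : FinMod k Λ) : DerivedCategory.Bounded (FinMod k Λ) :=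
  ⟨(DerivedCategory.singleFunctor (FinMod k Λ) 0).obj A,
    ⟨⟨0, inferInstance⟩, ⟨0, inferInstance⟩⟩⟩

/-- The property of objects of `D^b(mod Λ)` defining `U^(l) = add {A[il] | A ∈ mod Λ, i ∈ ℤ}`. -/
def veroneseProp (l : ℕ) : ObjectProperty (DerivedCategory.Bounded (FinMod k Λ)) :=
  addClosure fun X => ∃ (A : FinMod k Λ) (i : ℤ), X = (stalk k Λ A)⟦i * (l : ℤ)⟧

/-- The full subcategory `U^(l) = add {A[il] | A ∈ mod Λ, i ∈ ℤ}` of `D^b(mod Λ)`. -/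
abbrev VeroneseCat (l : ℕ) : Type _ := (veroneseProp k Λ l).FullSubcategory

end VeroneseCat

/-! ### The Veronese subalgebra of the Yoneda algebra -/

section VeroneseAlgebra

open Abelian

variable {C : Type u} [Category.{v} C] [Abelian C] [HasExt.{w} C]

/-- The degree `i` component `Ext^{li}(M, M)` of the `l`-th Veronese subalgebra. -/
abbrev VeroneseComponent (M : C) (l i : ℕ) : Type w := Ext M M (l * i)

lemma veroneseComponent_sigma_ext {M : C} {l i j : ℕ} (hij : i = j)
    (α : VeroneseComponent M l i) (β : VeroneseComponent M l j)
    (h : α.comp (Ext.mk₀ (𝟙 M)) (show l * i + 0 = l * j by rw [hij, add_zero]) = β) :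
    (⟨i, α⟩ : GradedMonoid (VeroneseComponent M l)) = ⟨j, β⟩ := by
  subst hij
  rw [Ext.comp_mk₀_id] at h
  rw [h]

/-- The unit of the Yoneda product. -/
noncomputable instance veroneseGOne (M : C) (l : ℕ) :
    GradedMonoid.GOne (VeroneseComponent M l) where
  one := (Ext.mk₀ (𝟙 M) : Ext M M 0)

/-- The Yoneda product, the product of `α` and `β` being `α` followed by `β`. -/
noncomputable instance veroneseGMul (M : C) (l : ℕ) :
    GradedMonoid.GMul (VeroneseComponent M l) where
  mul {i j} α β := Ext.comp α β (mul_add l i j).symm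

noncomputable instance veroneseGMonoid (M : C) (l : ℕ) :
    GradedMonoid.GMonoid (VeroneseComponent M l) where
  one_mul := by
    rintro ⟨i, α⟩
    refine veroneseComponent_sigma_ext (zero_add i) _ _ ?_
    change ((Ext.mk₀ (𝟙 M)).comp α (show 0 + l * i = l * (0 + i) by rw [zero_add, zero_add])).comp
      (Ext.mk₀ (𝟙 M)) _ = α
    rw [Ext.comp_assoc _ _ _ _ (add_zero (l * i)) (by lia), Ext.comp_mk₀_id, Ext.mk₀_id_comp]
  mul_one := by
    rintro ⟨i, α⟩
    exact veroneseComponent_sigma_ext (add_zero i) _ _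
      ((Ext.comp_mk₀_id _).trans (Ext.comp_mk₀_id α))
  mul_assoc := by
    rintro ⟨i, α⟩ ⟨j, β⟩ ⟨m, γ⟩
    refine veroneseComponent_sigma_ext (add_assoc i j m) _ _ ?_
    change ((Ext.comp (Ext.comp α β (mul_add l i j).symm) γ
      (mul_add l (i + j) m).symm).comp (Ext.mk₀ (𝟙 M)) _ :
        Ext M M (l * (i + (j + m)))) =
      Ext.comp α (Ext.comp β γ (mul_add l j m).symm) (mul_add l i (j + m)).symm
    rw [Ext.comp_assoc _ γ _ _ (add_zero (l * m)) (by ring), Ext.comp_mk₀_id,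
      Ext.comp_assoc α β γ _ (mul_add l j m).symm (by ring)]

noncomputable instance veroneseGRing (M : C) (l : ℕ) :
    DirectSum.GRing (VeroneseComponent M l) where
  __ := veroneseGMonoid M l
  mul_zero α := Ext.comp_zero α _ _ _ _
  zero_mul β := by apply Ext.zero_comp
  mul_add α β γ := Ext.comp_add α β γ _
  add_mul α β γ := Ext.add_comp α β γ _
  natCast n := (Ext.mk₀ (n • 𝟙 M) : Ext M M 0)
  natCast_zero := by
    show (Ext.mk₀ ((0 : ℕ) • 𝟙 M) : Ext M M 0) = 0
    simp
  natCast_succ n := by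
    show (Ext.mk₀ ((n + 1) • 𝟙 M) : Ext M M 0) = Ext.mk₀ (n • 𝟙 M) + Ext.mk₀ (𝟙 M)
    rw [succ_nsmul, Ext.mk₀_add]
  intCast n := (Ext.mk₀ (n • 𝟙 M) : Ext M M 0)
  intCast_ofNat n := by
    show (Ext.mk₀ ((n : ℤ) • 𝟙 M) : Ext M M 0) = Ext.mk₀ (n • 𝟙 M)
    rw [natCast_zsmul]
  intCast_negSucc_ofNat n := by
    show (Ext.mk₀ (Int.negSucc n • 𝟙 M) : Ext M M 0) = -Ext.mk₀ ((n + 1) • 𝟙 M)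
    rw [negSucc_zsmul, Ext.mk₀_neg]

/-- The Veronese subalgebra `Γ^(l) = ⨁_{i ≥ 0} Ext^{il}(M, M)` of the Yoneda algebra of `M`,
a ring under the Yoneda product. -/
abbrev VeroneseAlgebra (M : C) (l : ℕ) : Type w := DirectSum ℕ (VeroneseComponent M l)

end VeroneseAlgebra

/-! Write `P(Z)` for the projective module of all morphisms into `Z`, in every degree divisible by
`l`, and `S(Z)` for its quotient by the elements of positive degree, which is `Hom(-, Z)` placed in
degree zero. Both make sense over `U^(l)` and, as `⨁ Ext^{il}(M, Z)` and its top, over `Γ^(l)`.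

Let `I^•` be an injective coresolution of `Z` in `mod Λ`, with cosyzygies `Ω^{-i} Z`. By dimension
shifting, the map `Ext^s(X, Ω^{-l} Z) → Ext^{s+l}(X, Z)` is surjective for all `s ≥ 0` and bijective
for `s > 0`, and for `s = 0` its kernel consists of the morphisms which factor through `I^{l-1}`. As
`P(I) = S(I)` for injective `I`, this gives an exact sequence `0 → S(Ω^{-(l-1)} Z) → P(I^{l-1}) →
P(Ω^{-l} Z) → P(Z) → S(Z) → 0`. Because `l ≥ 2`, both cosyzygies have injective dimension at most `n
+ 1` when `Z` has injective dimension at most `n + 2`; and if the injective dimension of `Z` is at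
most `1`, then already `P(Z) = S(Z)`. Hence `pd S(Z) ≤ 3n` whenever `id Z ≤ n + 1`
(`Stratification.dim_S`).

Let now `F` be the cokernel of a morphism `P(W) → P(Z)`. The kernel of its degree zero part `S(W) →
S(Z)` is `S(K)`, with `K` a kernel in `mod Λ`, so the cokernel `F'` of this degree zero part has
projective dimension at most `3(d - 1) + 2 = 3d - 1`. The kernel of `F → F'` is a quotient of
`P(Ω^{-l} Z)`, and it is again a cokernel of a morphism between modules `P`, by coherence. Induction
on the injective dimension of `Z` gives `pd F ≤ 3d - 1` (`Stratification.dim_cokernel`). Coherence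
itself follows by a similar induction (`Stratification.exists_cover_kernel`).

`Stratification` isolates what this argument needs, and `GradedHom.IsResolving` isolates the input
from dimension shifting. The latter holds for `Ext` and, through projective resolutions, for its
opposite, so the statements on the right are those on the left for opposite objects. `Realization`
and `GradedHom.EndRing` lead to the two stratifications. For the ring, arbitrary modules have to be
bounded: Baer's criterion reduces this to cyclic modules, which are finitely presented because
`Γ^(l)` is noetherian. -/

open Opposite

universe v' u'

/-! ### Exact pairs of morphisms in an abelian category -/

section ExactPair

variable {C : Type u} [Category.{v} C] [Abelian C]

/-- Two composable morphisms form an exact sequence `X ⟶ Y ⟶ Z`. -/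
def ExactPair {X Y Z : C} (f : X ⟶ Y) (g : Y ⟶ Z) : Prop :=
  ∃ w : f ≫ g = 0, (ShortComplex.mk f g w).Exact

namespace ExactPair

variable {X Y Z : C} {f : X ⟶ Y} {g : Y ⟶ Z}

lemma refine_up (h : ExactPair f g) {A : C} (x : A ⟶ Y) (hx : x ≫ g = 0) :
    ∃ (A' : C) (p : A' ⟶ A) (_ : Epi p) (x₁ : A' ⟶ X), p ≫ x = x₁ ≫ f :=
  h.choose_spec.exact_up_to_refinements x hx

lemma of_refinements (w : f ≫ g = 0) (h : ∀ ⦃A : C⦄ (x : A ⟶ Y) (_ : x ≫ g = 0),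
    ∃ (A' : C) (p : A' ⟶ A) (_ : Epi p) (x₁ : A' ⟶ X), p ≫ x = x₁ ≫ f) : ExactPair f g :=
  ⟨w, (ShortComplex.exact_iff_exact_up_to_refinements _).2 h⟩

lemma exists_lift (h : ExactPair f g) {P : C} [Projective P] (x : P ⟶ Y) (hx : x ≫ g = 0) :
    ∃ y : P ⟶ X, y ≫ f = x :=
  ⟨h.choose_spec.liftFromProjective x hx, h.choose_spec.liftFromProjective_comp x hx⟩

lemma cokernel_π (f : X ⟶ Y) : ExactPair f (cokernel.π f) :=
  ⟨by simp, ShortComplex.exact_cokernel f⟩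

lemma epi_comp (h : ExactPair f g) {W : C} (e : W ⟶ X) [Epi e] : ExactPair (e ≫ f) g := by
  refine of_refinements (by rw [Category.assoc, h.choose, comp_zero]) fun A x hx => ?_
  obtain ⟨A', p, _, x₁, h₁⟩ := h.refine_up x hx
  obtain ⟨A'', p', _, x₂, h₂⟩ := surjective_up_to_refinements_of_epi e x₁
  exact ⟨A'', p' ≫ p, inferInstance, x₂, by rw [Category.assoc, h₁, ← Category.assoc, h₂,
    Category.assoc]⟩

/-- Cuts a long exact sequence at `Y` into short exact pieces between images, the form to which
dimension shifting applies. -/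
lemma shortExact (h : ExactPair f g) :
    (ShortComplex.mk (Abelian.image.ι f) (Abelian.factorThruImage g) (by
      rw [← cancel_mono (Abelian.image.ι g), ← cancel_epi (Abelian.factorThruImage f)]
      simp [h.choose])).ShortExact := by
  have w : Abelian.image.ι f ≫ g = 0 := by
    rw [← cancel_epi (Abelian.factorThruImage f)]; simp [h.choose]
  have : ExactPair (Abelian.image.ι f) g := by
    refine of_refinements w fun A x hx => ?_
    obtain ⟨A', p, hp, x₁, h₁⟩ := h.refine_up x hx
    exact ⟨A', p, hp, x₁ ≫ Abelian.factorThruImage f, by simp [h₁]⟩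
  refine ShortComplex.ShortExact.mk' ?_ inferInstance inferInstance
  rw [ShortComplex.exact_iff_exact_up_to_refinements]
  intro A x hx
  refine this.refine_up x ?_
  dsimp at x hx
  rw [← Abelian.image.fac g, ← Category.assoc, hx, zero_comp]

/-- One step of dimension shifting; applied successively along a resolution, each step costs one
dimension. -/
lemma image_dim (h : ExactPair f g) (n : ℕ)
    (h₁ : HasProjectiveDimensionLT (Abelian.image f) n)
    (h₂ : HasProjectiveDimensionLT Y (n + 1)) :
    HasProjectiveDimensionLT (Abelian.image g) (n + 1) :=
  h.shortExact.hasProjectiveDimensionLT_X₃ n h₁ h₂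

/-- If `X ⟶ Y ⟶ Z ⟶ 0` is exact, then `Z` is a cokernel. -/
lemma iso_cokernel (h : ExactPair f g) [Epi g] : Nonempty (cokernel f ≅ Z) := by
  have := h.choose_spec.gIsCokernel
  exact ⟨(cokernelIsCokernel f).coconePointUniqueUpToIso this⟩

end ExactPair

lemma image_iso_of_mono {X Y : C} (f : X ⟶ Y) [Mono f] : Nonempty (X ≅ Abelian.image f) := by
  have : Mono (Abelian.factorThruImage f) := by
    have : Mono (Abelian.factorThruImage f ≫ Abelian.image.ι f) := by rwa [Abelian.image.fac]
    exact mono_of_mono _ (Abelian.image.ι f)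
  have := isIso_of_mono_of_epi (Abelian.factorThruImage f)
  exact ⟨asIso (Abelian.factorThruImage f)⟩

lemma image_iso_of_epi {X Y : C} (f : X ⟶ Y) [Epi f] : Nonempty (Abelian.image f ≅ Y) := by
  have : Epi (Abelian.image.ι f) := by
    have : Epi (Abelian.factorThruImage f ≫ Abelian.image.ι f) := by rwa [Abelian.image.fac]
    exact epi_of_epi (Abelian.factorThruImage f) _
  have := isIso_of_mono_of_epi (Abelian.image.ι f)
  exact ⟨asIso (Abelian.image.ι f)⟩

end ExactPair

/-! ### Stratified families of projective objects -/

/-- A family of projective objects `P a` of an abelian category, each with a quotient `S a`, such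
that the kernel of `P b ⟶ P a` is modulo the kernels of `P b ⟶ S b` again of the form `S c`, and
such that `P a ⟶ S a` can be resolved, by objects of smaller rank. -/
structure Stratification (M : Type u) [Category.{v} M] [Abelian M] (ι : Type t) where
  P : ι → M
  S : ι → M
  π (a : ι) : P a ⟶ S a
  epi_π (a : ι) : Epi (π a)
  proj (a : ι) : Projective (P a)
  R : ℕ → ι → Prop
  exists_sum (a b : ι) : ∃ (c : ι) (f : P c ⟶ P a ⊞ P b), Epi f
  exists_kernel {a b : ι} (f : P b ⟶ P a) : ∃ (c : ι) (m : P c ⟶ P b) (m' : S c ⟶ S b)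
    (g : S b ⟶ S a), m ≫ π b = π c ≫ m' ∧ f ≫ π a = π b ≫ g ∧ Mono m' ∧ ExactPair m' g
  mono_π {a : ι} (h : R 0 a) : Mono (π a)
  exists_resolution {n : ℕ} {a : ι} (h : R (n + 1) a) : ∃ (a' c b : ι) (j : S a' ⟶ P c)
    (p : P c ⟶ P b) (q : P b ⟶ P a), R n a' ∧ R n b ∧ Mono j ∧ ExactPair j p ∧ ExactPair p q ∧
    ExactPair q (π a)

namespace Stratification

variable {M : Type u} [Category.{v} M] [Abelian M] {ι : Type t} (D : Stratification M ι)

attribute [instance] Stratification.epi_π Stratification.proj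

/-- In positive rank the cover is part of the resolution; in rank zero the kernel vanishes and the
zero morphism covers it. -/
lemma exists_cover_ker_π {n : ℕ} {a : ι} (h : D.R n a) :
    ∃ (e : ι) (q : D.P e ⟶ D.P a), ExactPair q (D.π a) := by
  obtain _ | n := n
  · have := D.mono_π h
    refine ⟨a, 0, ExactPair.of_refinements zero_comp fun A x hx => ?_⟩
    refine ⟨A, 𝟙 A, inferInstance, 0, ?_⟩
    rw [Category.id_comp, zero_comp, ← cancel_mono (D.π a), hx, zero_comp]
  · obtain ⟨a', c, b, j, p, q, -, -, -, -, -, h⟩ := D.exists_resolution h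
    exact ⟨b, q, h⟩

-- The elements of `P b` that `f` sends into the radical `ker (π a)` are, modulo `ker (π b)`, the
-- kernel `S c₀` of the induced map `S b ⟶ S a`. So they are covered by a lift of `P c₀ ⟶ S c₀ ⟶ S
-- b` together with a cover of `ker (π b)`.
variable {D} in
lemma exists_cover_kernel_comp_π {N : ℕ} (hN : ∀ a, D.R N a) {a b : ι} (f : D.P b ⟶ D.P a) :
    ∃ (c : ι) (m : D.P c ⟶ D.P b), ExactPair m (f ≫ D.π a) := by
  obtain ⟨c₀, m, m', g, hm, hg, _, hmg⟩ := D.exists_kernel f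
  obtain ⟨e, q, hq⟩ := D.exists_cover_ker_π (hN b)
  obtain ⟨c, θ, _⟩ := D.exists_sum c₀ e
  refine ⟨c, θ ≫ biprod.desc m q, ExactPair.epi_comp ?_ θ⟩
  refine ExactPair.of_refinements ?_ fun A x hx => ?_
  · ext
    · simp [hg, reassoc_of% hm, hmg.choose]
    · simp [hg, reassoc_of% hq.choose]
  · obtain ⟨A₁, p₁, _, s, hs⟩ := hmg.refine_up (x ≫ D.π b) (by rw [Category.assoc, ← hg, hx])
    obtain ⟨A₂, p₂, _, y, hy⟩ := surjective_up_to_refinements_of_epi (D.π c₀) s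
    obtain ⟨A₃, p₃, _, z, hz⟩ := hq.refine_up (p₂ ≫ p₁ ≫ x - y ≫ m) (by
      rw [Preadditive.sub_comp, Category.assoc, Category.assoc, Category.assoc, hs,
        reassoc_of% hy, hm, sub_self])
    refine ⟨A₃, p₃ ≫ p₂ ≫ p₁, inferInstance, biprod.lift (p₃ ≫ y) z, ?_⟩
    rw [biprod.lift_desc, ← hz]
    simp

variable {D} in
/-- Kernels of morphisms between the projective objects of the family are covered by the family. -/
lemma exists_cover_kernel {N : ℕ} (hN : ∀ a, D.R N a) {n : ℕ} {a b : ι} (ha : D.R n a)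
    (f : D.P b ⟶ D.P a) : ∃ (c : ι) (m : D.P c ⟶ D.P b), ExactPair m f := by
  induction n generalizing a b with
  | zero =>
    obtain ⟨c₀, φ, hφ⟩ := exists_cover_kernel_comp_π hN f
    have := D.mono_π ha
    refine ⟨c₀, φ, ExactPair.of_refinements ?_ fun A x hx => ?_⟩
    · rw [← cancel_mono (D.π a), Category.assoc, hφ.choose, zero_comp]
    · exact hφ.refine_up x (by rw [reassoc_of% hx, zero_comp])
  | succ n ih =>
    obtain ⟨c₀, φ, hφ⟩ := exists_cover_kernel_comp_π hN f
    obtain ⟨a', J, y, j, p, q, -, hy, -, -, hpq, hq⟩ := D.exists_resolution ha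
    -- On the cover `φ` of `ker (f ≫ π a)`, the map `f` lands in the image of `q` and lifts to `f₂`.
    -- Then `φ x` lies in `ker f` exactly when `f₂ x` lies in `ker q = im p`, so `ker f` is the
    -- image of the kernel of `(f₂, p)`. The target `P y` of that map has smaller rank.
    obtain ⟨f₂, hf₂⟩ := hq.exists_lift (φ ≫ f) (by rw [Category.assoc, hφ.choose])
    obtain ⟨c₁, θ, _⟩ := D.exists_sum c₀ J
    obtain ⟨c, k, hk⟩ := ih hy (θ ≫ biprod.desc f₂ p)
    have hpq₀ : p ≫ q = 0 := hpq.choose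
    refine ⟨c, k ≫ θ ≫ biprod.fst ≫ φ, ExactPair.of_refinements ?_ fun A x hx => ?_⟩
    · have h₁ : biprod.fst ≫ f₂ = biprod.desc f₂ p - biprod.snd ≫ p := by
        ext <;> simp
      simp only [Category.assoc, ← hf₂]
      rw [reassoc_of% h₁, Preadditive.sub_comp, Category.assoc, hpq₀, comp_zero, sub_zero,
        ← Category.assoc θ, ← Category.assoc k, hk.choose, zero_comp]
    · obtain ⟨A₁, p₁, _, x₁, h₁⟩ := hφ.refine_up x (by rw [reassoc_of% hx, zero_comp])
      obtain ⟨A₃, p₃, _, z, h₃⟩ := hpq.refine_up (x₁ ≫ f₂) (by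
        rw [Category.assoc, hf₂, ← reassoc_of% h₁, hx, comp_zero])
      obtain ⟨A₄, p₄, _, t, h₄⟩ := surjective_up_to_refinements_of_epi θ
        (biprod.lift (p₃ ≫ x₁) (-z))
      obtain ⟨A₅, p₅, _, r, h₅⟩ := hk.refine_up t (by
        rw [← reassoc_of% h₄, biprod.lift_desc]
        simp [h₃])
      refine ⟨A₅, p₅ ≫ p₄ ≫ p₃ ≫ p₁, inferInstance, r, ?_⟩
      have h₆ : p₄ ≫ p₃ ≫ x₁ = t ≫ θ ≫ biprod.fst := by
        rw [← reassoc_of% h₄]; simp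
      simp only [Category.assoc, h₁]
      rw [reassoc_of% h₆, reassoc_of% h₅]

/-- A resolution has three projective terms between `S a'` and `S a`, so each unit of rank costs
three dimensions; in rank zero `S a` is itself projective. -/
lemma dim_S {n : ℕ} {a : ι} (ha : D.R n a) : HasProjectiveDimensionLT (D.S a) (3 * n + 1) := by
  induction n generalizing a with
  | zero =>
    have := D.mono_π ha
    have := isIso_of_mono_of_epi (D.π a)
    exact hasProjectiveDimensionLT_of_iso (asIso (D.π a)) 1
  | succ n ih =>
    obtain ⟨a', J, y, j, p, q, ha', -, _, hjp, hpq, hq⟩ := D.exists_resolution ha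
    have h₀ := ih ha'
    have hP : ∀ (b : ι) (k : ℕ), HasProjectiveDimensionLT (D.P b) (k + 1) := fun b k =>
      hasProjectiveDimensionLT_of_ge _ 1 _ (by lia)
    have h₁ : HasProjectiveDimensionLT (Abelian.image j) (3 * n + 1) :=
      hasProjectiveDimensionLT_of_iso (image_iso_of_mono j).some _
    have h₂ := hjp.image_dim _ h₁ (hP _ _)
    have h₃ := hpq.image_dim _ h₂ (hP _ _)
    have h₄ := hq.image_dim _ h₃ (hP _ _)
    exact hasProjectiveDimensionLT_of_iso (image_iso_of_epi (D.π a)).some _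

-- Compare `cokernel f` with the cokernel `F'` of the induced map `S b ⟶ S a`. The sequence `0 → S c
-- → S b → S a → F' → 0` bounds `F'` by `3N + 2`. The kernel of `cokernel f ⟶ F'` is again such a
-- cokernel, with a target of smaller rank. An extension does not exceed the larger bound, so the
-- induction on the rank adds nothing to `3N + 2`.
variable {D} in
lemma dim_cokernel {N : ℕ} (hN : ∀ a, D.R N a) {n : ℕ} {a b : ι} (ha : D.R n a)
    (f : D.P b ⟶ D.P a) : HasProjectiveDimensionLT (cokernel f) (3 * N + 3) := by
  -- The last clause describes the kernel of `r` by generalized elements: `x` dies in `F'` exactly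
  -- when, locally, it differs from an element of the image of `f` by an element of the radical `ker
  -- (π a)`.
  have key : ∀ {a b : ι} (f : D.P b ⟶ D.P a), ∃ (F' : M) (r : cokernel f ⟶ F'), Epi r ∧
      HasProjectiveDimensionLT F' (3 * N + 3) ∧ ∀ {A : M} (x : A ⟶ D.P a),
      (x ≫ cokernel.π f) ≫ r = 0 ↔ ∃ (A' : M) (p : A' ⟶ A) (_ : Epi p) (t : A' ⟶ D.P b),
        (p ≫ x - t ≫ f) ≫ D.π a = 0 := by
    intro a b f
    obtain ⟨c, m, m', g, hm, hg, _, hmg⟩ := D.exists_kernel f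
    refine ⟨cokernel g, cokernel.map f g _ _ hg, ?_, ?_, fun {A} x => ?_⟩
    · have : Epi (cokernel.π f ≫ cokernel.map f g (D.π b) (D.π a) hg) := by
        rw [cokernel.π_desc]; infer_instance
      exact epi_of_epi (cokernel.π f) _
    · have hS : ∀ (b : ι) (k : ℕ), HasProjectiveDimensionLT (D.S b) (3 * N + 1 + k) := fun b k =>
        have := D.dim_S (hN b)
        inferInstance
      have h₁ : HasProjectiveDimensionLT (Abelian.image m') (3 * N + 1) :=
        have := hS c 0
        hasProjectiveDimensionLT_of_iso (image_iso_of_mono m').some _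
      have h₂ := hmg.image_dim _ h₁ (hS _ 1)
      have h₃ := (ExactPair.cokernel_π g).image_dim _ h₂ (hS _ 2)
      exact hasProjectiveDimensionLT_of_iso (image_iso_of_epi (cokernel.π g)).some _
    · rw [Category.assoc, cokernel.π_desc]
      refine ⟨fun h => ?_, ?_⟩
      · obtain ⟨A₁, p₁, _, s, hs⟩ := (ExactPair.cokernel_π g).refine_up (x ≫ D.π a)
          (by rw [Category.assoc, h])
        obtain ⟨A₂, p₂, _, t, ht⟩ := surjective_up_to_refinements_of_epi (D.π b) s
        refine ⟨A₂, p₂ ≫ p₁, inferInstance, t, ?_⟩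
        rw [Preadditive.sub_comp, Category.assoc, Category.assoc, Category.assoc, hs, hg,
          reassoc_of% ht, sub_self]
      · rintro ⟨A', p, _, t, ht⟩
        rw [← cancel_epi p, comp_zero]
        rw [Preadditive.sub_comp, sub_eq_zero] at ht
        rw [← Category.assoc x, ← Category.assoc p, ← Category.assoc p, ht]
        simp [reassoc_of% hg]
  induction n generalizing a b with
  | zero =>
    obtain ⟨F', r, _, hF, hr⟩ := key f
    have := D.mono_π ha
    have : Mono r := by
      refine Preadditive.mono_of_cancel_zero _ fun {A} x hx => ?_
      obtain ⟨A₁, p₁, _, y, hy⟩ := surjective_up_to_refinements_of_epi (cokernel.π f) x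
      obtain ⟨A', p, _, t, ht⟩ := (hr y).1 (by rw [← hy, Category.assoc, hx, comp_zero])
      rw [← cancel_epi p₁, ← cancel_epi p, hy]
      rw [← zero_comp (f := D.π a), cancel_mono, sub_eq_zero] at ht
      rw [← Category.assoc, ht]
      simp
    have := isIso_of_mono_of_epi r
    exact hasProjectiveDimensionLT_of_iso (asIso r).symm _
  | succ n ih =>
    obtain ⟨F', r, _, hF, hr⟩ := key f
    obtain ⟨a', J, y, j, p, q, -, hy, -, -, -, hq⟩ := D.exists_resolution ha
    have hqr : (q ≫ cokernel.π f) ≫ r = 0 :=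
      (hr q).2 ⟨_, 𝟙 _, inferInstance, 0, by simp [hq.choose]⟩
    -- Since `q` covers `ker (π a)`, its composite with the projection to `cokernel f` covers
    -- `kernel r`.
    let l : D.P y ⟶ kernel r := kernel.lift r (q ≫ cokernel.π f) hqr
    have : Epi l := by
      rw [epi_iff_surjective_up_to_refinements]
      intro A x
      obtain ⟨A₁, p₁, _, x₁, h₁⟩ := surjective_up_to_refinements_of_epi (cokernel.π f)
        (x ≫ kernel.ι r)
      obtain ⟨A₂, p₂, _, t, ht⟩ := (hr x₁).1 (by rw [← h₁]; simp)
      obtain ⟨A₃, p₃, _, z, hz⟩ := hq.refine_up _ ht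
      refine ⟨A₃, p₃ ≫ p₂ ≫ p₁, inferInstance, z, ?_⟩
      rw [← cancel_mono (kernel.ι r)]
      simp only [l, Category.assoc, kernel.lift_ι, h₁]
      rw [← reassoc_of% hz]
      simp
    obtain ⟨c₁, θ, _⟩ := D.exists_sum y b
    -- The kernel of `l` consists of the elements `x` with `q x` in the image of `f`, i.e. of the
    -- first coordinates of the kernel of `(q, f)`.
    obtain ⟨c, k, hk⟩ := exists_cover_kernel hN ha (θ ≫ biprod.desc q f)
    have hkl : ExactPair (k ≫ θ ≫ biprod.fst) l := by
      refine ExactPair.of_refinements ?_ fun A x hx => ?_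
      · rw [← cancel_mono (kernel.ι r)]
        have h₁ : biprod.fst ≫ q = biprod.desc q f - biprod.snd ≫ f := by ext <;> simp
        simp only [l, Category.assoc, kernel.lift_ι, zero_comp]
        rw [reassoc_of% h₁, Preadditive.sub_comp, Category.assoc, cokernel.condition, comp_zero,
          sub_zero, ← Category.assoc θ, ← Category.assoc k, hk.choose, zero_comp]
      · obtain ⟨A₁, p₁, _, s, hs⟩ := (ExactPair.cokernel_π f).refine_up (x ≫ q) (by
          have := congrArg (· ≫ kernel.ι r) hx
          simpa [l] using this)
        obtain ⟨A₂, p₂, _, t, ht⟩ := surjective_up_to_refinements_of_epi θ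
          (biprod.lift (p₁ ≫ x) (-s))
        obtain ⟨A₃, p₃, _, z, hz⟩ := hk.refine_up t (by
          rw [← reassoc_of% ht, biprod.lift_desc]
          simp [hs])
        refine ⟨A₃, p₃ ≫ p₂ ≫ p₁, inferInstance, z, ?_⟩
        rw [← reassoc_of% hz, ← reassoc_of% ht]
        simp
    have h₁ : HasProjectiveDimensionLT (kernel r) (3 * N + 3) :=
      have := ih hy (k ≫ θ ≫ biprod.fst)
      hasProjectiveDimensionLT_of_iso hkl.iso_cokernel.some _
    have : (ShortComplex.mk (kernel.ι r) r (by simp)).ShortExact :=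
      { exact := ShortComplex.exact_kernel r }
    exact this.hasProjectiveDimensionLT_X₂ _ h₁ hF

/-- A version of `exists_cover_kernel` for retracts of objects of the family. -/
lemma exists_cover_kernel_of_retract {N : ℕ} (hN : ∀ a, D.R N a) {a b : ι} {X Y : M}
    (rX : Retract X (D.P a)) (rY : Retract Y (D.P b)) (f : Y ⟶ X) :
    ∃ (c : ι) (m : D.P c ⟶ Y), ExactPair m f := by
  obtain ⟨c, m, hm⟩ := exists_cover_kernel hN (hN a) (rY.r ≫ f ≫ rX.i)
  refine ⟨c, m ≫ rY.r, ExactPair.of_refinements ?_ fun A x hx => ?_⟩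
  · rw [← cancel_mono rX.i]
    simpa using hm.choose
  · obtain ⟨A₁, p₁, _, x₁, h₁⟩ := hm.refine_up (x ≫ rY.i) (by simp [reassoc_of% hx])
    refine ⟨A₁, p₁, inferInstance, x₁, ?_⟩
    rw [← reassoc_of% h₁]
    simp

/-- An object with a presentation by quotients of objects of the family has finite projective
dimension. -/
lemma dim_of_presentation {N : ℕ} (hN : ∀ a, D.R N a) {a b : ι} {X Y Z : M}
    (rX : Retract X (D.P a)) (e : D.P b ⟶ Y) [Epi e] (f : Y ⟶ X) (g : X ⟶ Z) [Epi g]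
    (h : ExactPair f g) : HasProjectiveDimensionLT Z (3 * N + 3) := by
  obtain ⟨c, θ, _⟩ := D.exists_sum b a
  -- Replaces the summand `X` by all of `P a`: the relations `1 - r i` kill the complementary
  -- summand.
  have h' : ExactPair (biprod.desc (e ≫ f ≫ rX.i) (𝟙 _ - rX.r ≫ rX.i)) (rX.r ≫ g) := by
    refine ExactPair.of_refinements ?_ fun A x hx => ?_
    · ext
      · simp [h.choose]
      · simp
    · obtain ⟨A₁, p₁, _, x₁, h₁⟩ := (h.epi_comp e).refine_up (x ≫ rX.r) (by simpa using hx)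
      refine ⟨A₁, p₁, inferInstance, biprod.lift x₁ (p₁ ≫ x), ?_⟩
      rw [biprod.lift_desc]
      simp [← reassoc_of% h₁]
  have := dim_cokernel hN (hN a) (θ ≫ biprod.desc (e ≫ f ≫ rX.i) (𝟙 _ - rX.r ≫ rX.i))
  exact hasProjectiveDimensionLT_of_iso (h'.epi_comp θ).iso_cokernel.some _

end Stratification

/-! ### Graded morphism groups -/

/-- Graded morphism groups `E A B n`, `n ≥ 0`, between the objects of a preadditive category, with
a composition which in degree zero is the composition of the category. -/
structure GradedHom (A : Type u) [Category.{v} A] [Preadditive A] where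
  E : A → A → ℕ → Type w
  [grp : ∀ X Y n, AddCommGroup (E X Y n)]
  comp {X Y Z : A} {m n p : ℕ} (h : m + n = p) : E X Y m →+ E Y Z n →+ E X Z p
  assoc {X Y Z W : A} {m n p mn np mnp : ℕ} (h : m + n = mn) (h' : n + p = np) (h₁ : mn + p = mnp)
    (h₂ : m + np = mnp) (α : E X Y m) (β : E Y Z n) (γ : E Z W p) :
    comp h₁ (comp h α β) γ = comp h₂ α (comp h' β γ)
  of {X Y : A} : (X ⟶ Y) ≃+ E X Y 0
  of_comp {X Y Z : A} (f : X ⟶ Y) (g : Y ⟶ Z) : comp (zero_add 0) (of f) (of g) = of (f ≫ g)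
  id_comp {X Y : A} {n : ℕ} (α : E X Y n) : comp (zero_add n) (of (𝟙 X)) α = α
  comp_id {X Y : A} {n : ℕ} (α : E X Y n) : comp (add_zero n) α (of (𝟙 Y)) = α

namespace GradedHom

attribute [instance] GradedHom.grp

variable {A : Type u} [Category.{v} A] [Preadditive A]

/-- The graded morphism groups of the opposite category. -/
def op (Y : GradedHom.{w} A) : GradedHom.{w} Aᵒᵖ where
  E X Z n := Y.E Z.unop X.unop n
  comp {_ _ _} {m n _} h := (Y.comp (show n + m = _ by rw [add_comm, h])).flip
  assoc h h' h₁ h₂ α β γ := (Y.assoc _ _ _ _ γ β α).symm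
  of := { (opEquiv _ _).trans Y.of.toEquiv with map_add' := fun f g => Y.of.map_add f.unop g.unop }
  of_comp f g := Y.of_comp g.unop f.unop
  id_comp α := Y.comp_id α
  comp_id α := Y.id_comp α

end GradedHom

/-- A rank function on the objects of an abelian category with graded morphism groups, such that
objects of rank zero are acyclic, and such that objects of positive rank have resolutions by
objects of smaller rank. -/
structure GradedHom.IsResolving {A : Type u} [Category.{v} A] [Abelian A] (Y : GradedHom.{w} A)
    (R : ℕ → A → Prop) : Prop where
  eq_zero {Z : A} (h : R 0 Z) (X : A) {n : ℕ} (α : Y.E X Z (n + 1)) : α = 0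
  exists_resolution {n : ℕ} {Z : A} (h : R (n + 1) Z) : ∃ (S : ShortComplex A) (_ : S.ShortExact)
    (η : Y.E S.X₃ Z 1), R 0 S.X₂ ∧ R n S.X₁ ∧ R n S.X₃ ∧ Y.comp (zero_add 1) (Y.of S.g) η = 0 ∧
    (∀ (X : A) (m : ℕ) (α : Y.E X Z (m + 1)), ∃ β : Y.E X S.X₃ m, Y.comp rfl β η = α) ∧
    (∀ (X : A) (m : ℕ) (β : Y.E X S.X₃ (m + 1)), Y.comp rfl β η = 0 → β = 0) ∧
    (∀ (X : A) (f : X ⟶ S.X₃), Y.comp (zero_add 1) (Y.of f) η = 0 → ∃ g, g ≫ S.g = f)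

/-! ### Extension groups in degrees divisible by `l` -/

namespace CategoryTheory.Abelian.Ext

variable {C : Type u} [Category.{v} C] [Abelian C] [HasExt.{w} C]

/-- The extension groups in degrees divisible by `l`. -/
noncomputable def veronese (C : Type u) [Category.{v} C] [Abelian C] [HasExt.{w} C] (l : ℕ) :
    GradedHom.{w} C where
  E X Y n := Ext X Y (l * n)
  comp {X Y Z m n p} h := bilinearComp X Y Z (l * m) (l * n) (l * p) (by rw [← h, mul_add])
  assoc h h' h₁ h₂ α β γ := by
    subst h h' h₁
    exact comp_assoc α β γ (mul_add _ _ _).symm (mul_add _ _ _).symm (by ring)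
  of := addEquiv₀.symm
  of_comp f g := mk₀_comp_mk₀ f g
  id_comp α := mk₀_id_comp α
  comp_id α := comp_mk₀_id α

/-- Iterated dimension shifting along injective objects. -/
lemma exists_iterated_cosyzygy [EnoughInjectives C] (Z : C) {m q : ℕ} (hq : m + 1 = q) :
    ∃ (S : ShortComplex C) (_ : S.ShortExact) (_ : Injective S.X₂) (η : Ext S.X₃ Z q),
      (mk₀ S.g).comp η (zero_add _) = 0 ∧
      (∀ (X : C) {s p : ℕ} (h : s + q = p) (y : Ext X Z p),
        ∃ x : Ext X S.X₃ s, x.comp η h = y) ∧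
      (∀ (X : C) {s p : ℕ} (h : s + q = p) (_ : s ≠ 0) (x : Ext X S.X₃ s),
        x.comp η h = 0 → x = 0) ∧
      (∀ (X : C) (f : X ⟶ S.X₃), (mk₀ f).comp η (zero_add _) = 0 → ∃ g, g ≫ S.g = f) ∧
      (∀ k : ℕ, HasInjectiveDimensionLT Z (k + 3) → HasInjectiveDimensionLT S.X₃ (k + 2) ∧
        (m ≠ 0 → HasInjectiveDimensionLT S.X₁ (k + 2))) := by
  have hf : ∀ (S : ShortComplex C) (hS : S.ShortExact) {X : C} (f : X ⟶ S.X₃),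
      (mk₀ f).comp hS.extClass (zero_add 1) = 0 → ∃ g, g ≫ S.g = f := by
    intro S hS X f hf
    obtain ⟨g, hg⟩ := covariant_sequence_exact₃ X hS (mk₀ f) (zero_add 1) hf
    obtain ⟨g, rfl⟩ := (mk₀_bijective _ _).2 g
    exact ⟨g, (mk₀_bijective _ _).1 (by rw [← hg, mk₀_comp_mk₀])⟩
  subst hq
  induction m with
  | zero =>
    obtain ⟨J⟩ := EnoughInjectives.presentation Z
    have hS : (ShortComplex.mk _ _ (cokernel.condition J.f)).ShortExact :=
      { exact := ShortComplex.exact_cokernel J.f }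
    have : Injective J.J := J.injective
    refine ⟨_, hS, this, hS.extClass, hS.comp_extClass, fun X s p h y => ?_,
      fun X s p h hs x hx => ?_, fun X f hf' => hf _ hS f hf', fun k hk => ⟨?_, by simp⟩⟩
    · obtain rfl : s + 1 = p := by lia
      exact covariant_sequence_exact₁ X hS y (eq_zero_of_injective _) rfl
    · obtain ⟨s, rfl⟩ := Nat.exists_eq_succ_of_ne_zero hs
      obtain ⟨y, rfl⟩ := covariant_sequence_exact₃ X hS x h hx
      rw [eq_zero_of_injective y, zero_comp]
    · exact hS.hasInjectiveDimensionLT_X₃ _ (hasInjectiveDimensionLT_of_ge J.J 1 _ (by lia)) hk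
  | succ m ih =>
    obtain ⟨S', hS', _, η', -, h₁, h₂, h₃, h₄⟩ := ih
    obtain ⟨J⟩ := EnoughInjectives.presentation S'.X₃
    have hS : (ShortComplex.mk _ _ (cokernel.condition J.f)).ShortExact :=
      { exact := ShortComplex.exact_cokernel J.f }
    have : Injective J.J := J.injective
    have hη {X : C} {s p : ℕ} (h : s + (m + 1 + 1) = p) (x : Ext X (cokernel J.f) s) :
        x.comp (hS.extClass.comp η' (add_comm 1 (m + 1))) h =
          (x.comp hS.extClass rfl).comp η' (by lia) :=
      (comp_assoc x hS.extClass η' rfl _ (by lia)).symm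
    refine ⟨_, hS, this, hS.extClass.comp η' (add_comm 1 (m + 1)), ?_, fun X s p h y => ?_,
      -- The new class is the Yoneda product of the extension class of one further cosyzygy with the
      -- old class `η'`. Both end terms of the new sequence have had at least one cosyzygy taken, so
      -- the dimension bound drops for both; for `m = 0` the left term is `Z` itself.
      fun X s p h hs x hx => ?_, fun X f hf' => ?_, fun k hk => ⟨?_, fun _ => (h₄ k hk).1⟩⟩
    · dsimp only
      rw [hη, hS.comp_extClass, zero_comp]
    · obtain ⟨x, rfl⟩ := h₁ X (show s + 1 + (m + 1) = p by lia) y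
      obtain ⟨x, rfl⟩ := covariant_sequence_exact₁ X hS x (eq_zero_of_injective _) rfl
      exact ⟨x, hη _ _⟩
    · rw [hη] at hx
      have := h₂ X _ (by lia) _ hx
      obtain ⟨s, rfl⟩ := Nat.exists_eq_succ_of_ne_zero hs
      obtain ⟨y, rfl⟩ := covariant_sequence_exact₃ X hS x rfl this
      rw [eq_zero_of_injective y, zero_comp]
    · dsimp only at hf'
      rw [hη] at hf'
      exact hf _ hS f (h₂ X _ (by lia) _ hf')
    · exact hS.hasInjectiveDimensionLT_X₃ _ (hasInjectiveDimensionLT_of_ge J.J 1 _ (by lia))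
        (have := (h₄ k hk).1; hasInjectiveDimensionLT_of_ge S'.X₃ (k + 2) _ (by lia))

/-- Iterated dimension shifting along projective objects. -/
lemma exists_iterated_syzygy [EnoughProjectives C] (Z : C) {m q : ℕ} (hq : m + 1 = q) :
    ∃ (S : ShortComplex C) (_ : S.ShortExact) (_ : Projective S.X₂) (η : Ext Z S.X₁ q),
      η.comp (mk₀ S.f) (add_zero _) = 0 ∧
      (∀ (X : C) {s p : ℕ} (h : q + s = p) (y : Ext Z X p),
        ∃ x : Ext S.X₁ X s, η.comp x h = y) ∧
      (∀ (X : C) {s p : ℕ} (h : q + s = p) (_ : s ≠ 0) (x : Ext S.X₁ X s),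
        η.comp x h = 0 → x = 0) ∧
      (∀ (X : C) (f : S.X₁ ⟶ X), η.comp (mk₀ f) (add_zero _) = 0 → ∃ g, S.f ≫ g = f) ∧
      (∀ k : ℕ, HasProjectiveDimensionLT Z (k + 3) → HasProjectiveDimensionLT S.X₁ (k + 2) ∧
        (m ≠ 0 → HasProjectiveDimensionLT S.X₃ (k + 2))) := by
  have hf : ∀ (S : ShortComplex C) (hS : S.ShortExact) {X : C} (f : S.X₁ ⟶ X),
      hS.extClass.comp (mk₀ f) (add_zero 1) = 0 → ∃ g, S.f ≫ g = f := by
    intro S hS X f hf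
    obtain ⟨g, hg⟩ := contravariant_sequence_exact₁ hS X (mk₀ f) (add_zero 1) hf
    obtain ⟨g, rfl⟩ := (mk₀_bijective _ _).2 g
    exact ⟨g, (mk₀_bijective _ _).1 (by rw [← hg, mk₀_comp_mk₀])⟩
  subst hq
  induction m with
  | zero =>
    obtain ⟨J⟩ := EnoughProjectives.presentation Z
    have hS : (ShortComplex.mk _ _ (kernel.condition J.f)).ShortExact :=
      { exact := ShortComplex.exact_kernel J.f }
    have : Projective J.p := J.projective
    refine ⟨_, hS, this, hS.extClass, hS.extClass_comp, fun X s p h y => ?_,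
      fun X s p h hs x hx => ?_, fun X f hf' => hf _ hS f hf', fun k hk => ⟨?_, by simp⟩⟩
    · obtain rfl : 1 + s = p := by lia
      exact contravariant_sequence_exact₃ hS X y
        (HasProjectiveDimensionLT.subsingleton J.p 1 _ (by lia) X |>.elim _ _) rfl
    · obtain ⟨s, rfl⟩ := Nat.exists_eq_succ_of_ne_zero hs
      obtain ⟨y, rfl⟩ := contravariant_sequence_exact₁ hS X x h hx
      rw [eq_zero_of_projective y, comp_zero]
    · exact hS.hasProjectiveDimensionLT_X₁ _ (hasProjectiveDimensionLT_of_ge J.p 1 _ (by lia)) hk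
  | succ m ih =>
    obtain ⟨S', hS', _, η', -, h₁, h₂, h₃, h₄⟩ := ih
    obtain ⟨J⟩ := EnoughProjectives.presentation S'.X₁
    have hS : (ShortComplex.mk _ _ (kernel.condition J.f)).ShortExact :=
      { exact := ShortComplex.exact_kernel J.f }
    have : Projective J.p := J.projective
    have hη {X : C} {s p : ℕ} (h : (m + 1 + 1) + s = p) (x : Ext (kernel J.f) X s) :
        (η'.comp hS.extClass rfl).comp x h =
          η'.comp (hS.extClass.comp x rfl) (by lia) :=
      comp_assoc η' hS.extClass x _ _ (by lia)
    refine ⟨_, hS, this, η'.comp hS.extClass rfl, ?_, fun X s p h y => ?_,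
      fun X s p h hs x hx => ?_, fun X f hf' => ?_, fun k hk => ⟨?_, fun _ => (h₄ k hk).1⟩⟩
    · dsimp only
      rw [hη, hS.extClass_comp, comp_zero]
    · obtain ⟨x, rfl⟩ := h₁ X (show (m + 1) + (1 + s) = p by lia) y
      obtain ⟨x, rfl⟩ := contravariant_sequence_exact₃ hS X x
        (HasProjectiveDimensionLT.subsingleton J.p 1 _ (by lia) X |>.elim _ _) rfl
      exact ⟨x, hη _ _⟩
    · rw [hη] at hx
      have := h₂ X _ (by lia) _ hx
      obtain ⟨s, rfl⟩ := Nat.exists_eq_succ_of_ne_zero hs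
      obtain ⟨y, rfl⟩ := contravariant_sequence_exact₁ hS X x rfl this
      rw [eq_zero_of_projective y, comp_zero]
    · dsimp only at hf'
      rw [hη] at hf'
      exact hf _ hS f (h₂ X _ (by lia) _ hf')
    · exact hS.hasProjectiveDimensionLT_X₁ _ (hasProjectiveDimensionLT_of_ge J.p 1 _ (by lia))
        (have := (h₄ k hk).1; hasProjectiveDimensionLT_of_ge S'.X₁ (k + 2) _ (by lia))

/-- Rank `n` means injective dimension at most `n + 1`, not `n`: since `l ≥ 2`, injective dimension
one already kills all `Ext^{li}(-, Z)` with `i > 0`. This offset by one is what turns `3d + 2` into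
`3d - 1`. -/
lemma veronese_isResolving [EnoughInjectives C] {l : ℕ} (hl : 2 ≤ l) :
    (veronese C l).IsResolving fun n Z => HasInjectiveDimensionLT Z (n + 2) where
  eq_zero {Z} h X n α := eq_zero_of_hasInjectiveDimensionLT α 2
    (hl.trans (Nat.le_mul_of_pos_right _ (by lia)))
  exists_resolution {n Z} h := by
    -- Here `S` is `0 → Ω^{-(l-1)} Z → I^{l-1} → Ω^{-l} Z → 0`, and `η` is of degree `l` in `Ext`,
    -- hence of Veronese degree one. The index `l - 1` is nonzero, so the left term gains as well.
    obtain ⟨S, hS, _, η, h₁, h₂, h₃, h₄, h₅⟩ :=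
      exists_iterated_cosyzygy Z (show (l - 1) + 1 = l * 1 by lia)
    obtain ⟨h₅, h₆⟩ := h₅ n h
    exact ⟨S, hS, η, hasInjectiveDimensionLT_of_ge _ 1 _ (by lia), h₆ (by lia), h₅, h₁,
      fun X m α => h₂ X (mul_add l m 1).symm α, fun X m β hβ =>
        h₃ X (mul_add l _ 1).symm (Nat.mul_ne_zero (by lia) (by lia)) β hβ, h₄⟩

/-- The dual argument, with syzygies and projective dimension. -/
lemma veronese_op_isResolving [EnoughProjectives C] {l : ℕ} (hl : 2 ≤ l) :
    (veronese C l).op.IsResolving fun n Z => HasProjectiveDimensionLT Z.unop (n + 2) where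
  eq_zero {Z} h X n α := eq_zero_of_hasProjectiveDimensionLT (X := Z.unop) (Y := X.unop) α 2
    (hl.trans (Nat.le_mul_of_pos_right _ (by lia)))
  exists_resolution {n Z} h := by
    obtain ⟨S, hS, _, η, h₁, h₂, h₃, h₄, h₅⟩ :=
      exists_iterated_syzygy Z.unop (show (l - 1) + 1 = l * 1 by lia)
    obtain ⟨h₅, h₆⟩ := h₅ n h
    refine ⟨S.op, hS.op, η, hasProjectiveDimensionLT_of_ge S.X₂ 1 _ (by lia), h₆ (by lia), h₅, h₁,
      fun X m α => h₂ X.unop (show l * 1 + l * m = _ by ring) α,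
      fun X m β hβ =>
        h₃ X.unop (show l * 1 + l * (m + 1) = _ by ring)
          (Nat.mul_ne_zero (by lia) (by lia)) β hβ, fun X f hf => ?_⟩
    obtain ⟨g, hg⟩ := h₄ X.unop f.unop hf
    exact ⟨g.op, Quiver.Hom.unop_inj hg⟩

end CategoryTheory.Abelian.Ext

/-! ### Elements of modules over a preadditive category -/

section CatMod

variable {C : Type u} [Category.{v} C] [Preadditive C]

namespace CatMod

/-- The group of elements of a module at an object. -/
abbrev Elem (F : CatMod C) (X : C) : Type v := F.obj.obj (op X)

/-- The map induced by a morphism of modules on elements. -/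
def evalHom {F G : CatMod C} (f : F ⟶ G) (X : C) : F.Elem X →+ G.Elem X :=
  (f.hom.app (op X)).hom

/-- The contravariant action of morphisms on elements. -/
def res (F : CatMod C) {X Y : C} (g : X ⟶ Y) : F.Elem Y →+ F.Elem X := (F.obj.map g.op).hom

@[simp] lemma evalHom_comp {F G H : CatMod C} (f : F ⟶ G) (g : G ⟶ H) (X : C) (x : F.Elem X) :
    evalHom (f ≫ g) X x = evalHom g X (evalHom f X x) := rfl

@[simp] lemma evalHom_zero {F G : CatMod C} (X : C) (x : F.Elem X) :
    evalHom (0 : F ⟶ G) X x = 0 := rfl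

@[simp] lemma evalHom_id {F : CatMod C} (X : C) (x : F.Elem X) : evalHom (𝟙 F) X x = x := rfl

lemma evalHom_res {F G : CatMod C} (f : F ⟶ G) {X Y : C} (g : X ⟶ Y) (x : F.Elem Y) :
    evalHom f X (F.res g x) = G.res g (evalHom f Y x) := by
  have := f.hom.naturality g.op
  exact ConcreteCategory.congr_hom this x

lemma res_comp (F : CatMod C) {X Y Z : C} (f : X ⟶ Y) (g : Y ⟶ Z) (x : F.Elem Z) :
    F.res (f ≫ g) x = F.res f (F.res g x) := by
  have := F.obj.map_comp g.op f.op
  exact ConcreteCategory.congr_hom this x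

lemma res_id (F : CatMod C) {X : C} (x : F.Elem X) : F.res (𝟙 X) x = x := by
  have := F.obj.map_id (op X)
  exact ConcreteCategory.congr_hom this x

/-- The contravariant action, as a homomorphism in the morphism. -/
def resHom (F : CatMod C) (X Y : C) : (X ⟶ Y) →+ F.Elem Y →+ F.Elem X :=
  AddMonoidHom.mk' (fun g => F.res g) fun g h => by
    ext x
    have : F.obj.map (g.op + h.op) = F.obj.map g.op + F.obj.map h.op := F.obj.map_add
    exact ConcreteCategory.congr_hom this x

@[simp] lemma resHom_apply (F : CatMod C) {X Y : C} (g : X ⟶ Y) (x : F.Elem Y) :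
    F.resHom X Y g x = F.res g x := rfl

lemma hom_ext {F G : CatMod C} {f g : F ⟶ G} (h : ∀ X x, evalHom f X x = evalHom g X x) :
    f = g := by
  apply ObjectProperty.hom_ext
  ext X x
  exact h X.unop x

lemma evalHom_injective {F G : CatMod C} (f : F ⟶ G) [Mono f] (X : C) :
    Function.Injective (evalHom f X) := by
  have : (additiveFunctor Cᵒᵖ AddCommGrpCat.{v}).ι.PreservesMonomorphisms :=
    (additiveFunctor Cᵒᵖ AddCommGrpCat.{v}).preservesMonomorphisms_ι_of_isNormalEpiCategory
  have : Mono f.hom := inferInstanceAs (Mono ((additiveFunctor Cᵒᵖ AddCommGrpCat.{v}).ι.map f))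
  exact (AddCommGrpCat.mono_iff_injective _).1 (inferInstance : Mono (f.hom.app (op X)))

lemma evalHom_surjective {F G : CatMod C} (f : F ⟶ G) [Epi f] (X : C) :
    Function.Surjective (evalHom f X) := by
  have : (additiveFunctor Cᵒᵖ AddCommGrpCat.{v}).ι.PreservesEpimorphisms :=
    (additiveFunctor Cᵒᵖ AddCommGrpCat.{v}).preservesEpimorphisms_ι_of_isNormalMonoCategory
  have : Epi f.hom := inferInstanceAs (Epi ((additiveFunctor Cᵒᵖ AddCommGrpCat.{v}).ι.map f))
  exact (AddCommGrpCat.epi_iff_surjective _).1 (inferInstance : Epi (f.hom.app (op X)))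

end CatMod

/-- A family of objects such that the identity of every object is a finite sum of morphisms
which factor through the family. -/
def IsAddGenerating {ι : Type t} (G : ι → C) : Prop :=
  ∀ X : C, ∃ (n : ℕ) (i : Fin n → ι) (u : ∀ r, X ⟶ G (i r)) (v : ∀ r, G (i r) ⟶ X),
    ∑ r, u r ≫ v r = 𝟙 X

/-! ### Testing exactness on a generating family -/

namespace IsAddGenerating

open CatMod

variable {ι : Type t} {G : ι → C} (hG : IsAddGenerating G)
include hG

/-- An element at `X` is the sum of the restrictions along `u r` of its restrictions along `v r`,
and the latter live on the generating family. -/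
lemma mono_of_eval {F H : CatMod C} (f : F ⟶ H)
    (hf : ∀ i x, evalHom f (G i) x = 0 → x = 0) : Mono f := by
  refine Preadditive.mono_of_cancel_zero _ fun {K} g hg => hom_ext fun X x => ?_
  obtain ⟨n, i, u, v, h⟩ := hG X
  rw [← K.res_id x, ← h, ← resHom_apply, map_sum, AddMonoidHom.finsetSum_apply, map_sum, map_sum]
  refine Finset.sum_congr rfl fun r _ => ?_
  rw [resHom_apply, res_comp, evalHom_res, hf _ (evalHom g _ (K.res (v r) x)), map_zero,
    evalHom_zero]
  rw [← evalHom_comp, hg, evalHom_zero]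

lemma epi_of_eval {F H : CatMod C} (f : F ⟶ H)
    (hf : ∀ i, Function.Surjective (evalHom f (G i))) : Epi f := by
  refine Preadditive.epi_of_cancel_zero _ fun {K} g hg => hom_ext fun X x => ?_
  obtain ⟨n, i, u, v, h⟩ := hG X
  rw [← H.res_id x, ← h, ← resHom_apply, map_sum, AddMonoidHom.finsetSum_apply, map_sum, map_sum]
  refine Finset.sum_congr rfl fun r _ => ?_
  obtain ⟨y, hy⟩ := hf _ (H.res (v r) x)
  rw [resHom_apply, res_comp, evalHom_res, evalHom_zero, ← hy, ← evalHom_comp, hg, evalHom_zero,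
    map_zero]

lemma exactPair_of_eval {F H K : CatMod C} {f : F ⟶ H} {g : H ⟶ K}
    (w : ∀ i x, evalHom g (G i) (evalHom f (G i) x) = 0)
    (h : ∀ i x, evalHom g (G i) x = 0 → ∃ y, evalHom f (G i) y = x) : ExactPair f g := by
  have w' : f ≫ g = 0 := hom_ext fun X x => by
    obtain ⟨n, i, u, v, h⟩ := hG X
    rw [← F.res_id x, ← h, ← resHom_apply, map_sum, AddMonoidHom.finsetSum_apply, map_sum, map_sum]
    refine Finset.sum_congr rfl fun r _ => ?_
    rw [resHom_apply, res_comp, evalHom_res, evalHom_comp, w, map_zero, evalHom_zero]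
  refine ⟨w', ?_⟩
  rw [ShortComplex.exact_iff_epi_kernel_lift]
  refine hG.epi_of_eval _ fun i k => ?_
  obtain ⟨y, hy⟩ := h i (evalHom (kernel.ι g) _ k)
    (by rw [← evalHom_comp, kernel.condition, evalHom_zero])
  refine ⟨y, evalHom_injective (kernel.ι g) _ ?_⟩
  rw [← evalHom_comp, kernel.lift_ι]
  exact hy

end IsAddGenerating

/-! ### Representable modules and weak kernels -/

section Representable

open CatMod

/-- The morphism from a representable module given by an element. -/
def reprHom {F : CatMod C} {X : C} (x : F.Elem X) : reprMod X ⟶ F :=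
  ObjectProperty.homMk
    { app Y := AddCommGrpCat.ofHom ((F.resHom Y.unop X).flip x)
      naturality Y Z f := by
        ext g
        exact F.res_comp f.unop g x }

/-- The morphisms to an object, as elements of the representable module. -/
def reprElem {X Y : C} : (Y ⟶ X) ≃+ (reprMod X).Elem Y := AddEquiv.refl _

@[simp] lemma evalHom_reprHom {F : CatMod C} {X : C} (x : F.Elem X) {Y : C} (g : Y ⟶ X) :
    evalHom (reprHom x) Y (reprElem g) = F.res g x := rfl

@[simp] lemma reprMod_res {X Y Z : C} (f : Z ⟶ Y) (g : Y ⟶ X) :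
    (reprMod X).res f (reprElem g) = reprElem (f ≫ g) := rfl

lemma reprMod_hom_apply {F : CatMod C} {X : C} (f : reprMod X ⟶ F) {Y : C} (g : Y ⟶ X) :
    evalHom f Y (reprElem g) = F.res g (evalHom f X (reprElem (𝟙 X))) := by
  rw [← evalHom_res, reprMod_res, Category.comp_id]

lemma reprMod_hom_ext {F : CatMod C} {X : C} {f g : reprMod X ⟶ F}
    (h : evalHom f X (reprElem (𝟙 X)) = evalHom g X (reprElem (𝟙 X))) : f = g :=
  hom_ext fun Y y => by
    obtain ⟨y, rfl⟩ := reprElem.surjective y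
    rw [reprMod_hom_apply f y, reprMod_hom_apply g y, h]

instance reprMod_projective (X : C) : Projective (reprMod X) where
  factors {E F} f e _ := by
    obtain ⟨y, hy⟩ := evalHom_surjective e X (evalHom f X (reprElem (𝟙 X)))
    refine ⟨reprHom y, reprMod_hom_ext ?_⟩
    rw [evalHom_comp, evalHom_reprHom, evalHom_res, hy, res_id]

/-- The morphism of representable modules induced by a morphism. -/
def reprMap {X Y : C} (f : X ⟶ Y) : reprMod X ⟶ reprMod Y := reprHom (reprElem f)

@[simp] lemma evalHom_reprMap {X Y Z : C} (f : X ⟶ Y) (g : Z ⟶ X) :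
    evalHom (reprMap f) Z (reprElem g) = reprElem (g ≫ f) := rfl

lemma exists_eq_reprMap {X Y : C} (f : reprMod X ⟶ reprMod Y) : ∃ g : X ⟶ Y, f = reprMap g := by
  obtain ⟨g, hg⟩ := reprElem.surjective (evalHom f X (reprElem (𝟙 X)))
  exact ⟨g, reprMod_hom_ext (by rw [evalHom_reprMap, ← hg, Category.id_comp])⟩

lemma reprMap_comp {X Y Z : C} (f : X ⟶ Y) (g : Y ⟶ Z) :
    reprMap f ≫ reprMap g = reprMap (f ≫ g) :=
  reprMod_hom_ext (by simp)

lemma reprMap_injective {X Y : C} : Function.Injective (reprMap : (X ⟶ Y) → _) := fun f g h => by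
  simpa using congrArg (fun k => evalHom k X (reprElem (𝟙 X))) h

@[simp] lemma reprMap_zero {X Y : C} : reprMap (0 : X ⟶ Y) = 0 :=
  reprMod_hom_ext (by simp)

lemma reprMap_id {X : C} : reprMap (𝟙 X) = 𝟙 (reprMod X) :=
  reprMod_hom_ext (by simp)

/-- A retract of objects induces a retract of representable modules. -/
def reprRetract {X Y : C} (r : Retract X Y) : Retract (reprMod X) (reprMod Y) where
  i := reprMap r.i
  r := reprMap r.r
  retract := by rw [reprMap_comp, r.retract, reprMap_id]

/-- A morphism which covers the kernel of a morphism of representable modules is a weak kernel. -/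
lemma hasWeakKernel_of_exactPair {X Y Z : C} (f : X ⟶ Y) (m : reprMod Z ⟶ reprMod X)
    (h : ExactPair m (reprMap f)) : HasWeakKernel f := by
  obtain ⟨m, rfl⟩ := exists_eq_reprMap m
  have w : m ≫ f = 0 := reprMap_injective (by rw [← reprMap_comp, h.choose, reprMap_zero])
  have lift : ∀ s : Fork f 0, ∃ k : s.pt ⟶ Z, k ≫ m = s.ι := fun s => by
    obtain ⟨k, hk⟩ := h.exists_lift (reprMap s.ι) (by
      rw [reprMap_comp, s.condition, comp_zero, reprMap_zero])
    obtain ⟨k, rfl⟩ := exists_eq_reprMap k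
    exact ⟨k, reprMap_injective (by rw [← reprMap_comp, hk])⟩
  exact HasWeakLimit.mk
    { cone := Fork.ofι m (by rw [w, comp_zero])
      isWeakLimit := Fork.IsWeakLimit.mk' _ fun s => ⟨(lift s).choose, (lift s).choose_spec⟩ }

end Representable

/-! ### Two-sided ideals -/

/-- A two-sided ideal of a preadditive category. -/
structure HomIdeal (C : Type u) [Category.{v} C] [Preadditive C] where
  T (X Y : C) : AddSubgroup (X ⟶ Y)
  comp_left {X Y Z : C} (f : X ⟶ Y) {g : Y ⟶ Z} (hg : g ∈ T Y Z) : f ≫ g ∈ T X Z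
  comp_right {X Y Z : C} {f : X ⟶ Y} (g : Y ⟶ Z) (hf : f ∈ T X Y) : f ≫ g ∈ T X Z

namespace HomIdeal

open CatMod

variable (I : HomIdeal C)

/-- The functor of morphisms to an object modulo a two-sided ideal. -/
def quotFunctor (A : C) : Cᵒᵖ ⥤ AddCommGrpCat.{v} where
  obj X := AddCommGrpCat.of ((X.unop ⟶ A) ⧸ I.T X.unop A)
  map {X Y} f := AddCommGrpCat.ofHom (QuotientAddGroup.map _ _ (Preadditive.leftComp A f.unop)
    fun _ hg => I.comp_left f.unop hg)
  map_id X := by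
    ext x
    exact congrArg QuotientAddGroup.mk (Category.id_comp x)
  map_comp f g := by
    ext x
    exact congrArg QuotientAddGroup.mk (Category.assoc g.unop f.unop x)

instance (A : C) : (I.quotFunctor A).Additive where
  map_add {X Y f g} := by
    ext x
    obtain ⟨x, rfl⟩ := QuotientAddGroup.mk'_surjective (I.T X.unop A) x
    exact congrArg QuotientAddGroup.mk (Preadditive.add_comp _ _ _ f.unop g.unop x)

/-- The quotient of a representable module by a two-sided ideal. -/
def quot (A : C) : CatMod C := AdditiveFunctor.of (I.quotFunctor A)

/-- The class of a morphism modulo the ideal. -/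
def cls {X A : C} : (X ⟶ A) →+ (I.quot A).Elem X := QuotientAddGroup.mk' (I.T X A)

lemma cls_surjective {X A : C} (x : (I.quot A).Elem X) : ∃ f, I.cls f = x :=
  QuotientAddGroup.mk_surjective x

lemma cls_eq_zero {X A : C} (f : X ⟶ A) : I.cls f = 0 ↔ f ∈ I.T X A :=
  QuotientAddGroup.eq_zero_iff f

lemma quot_res {X Y A : C} (f : X ⟶ Y) (g : Y ⟶ A) :
    (I.quot A).res f (I.cls g) = I.cls (f ≫ g) := rfl

/-- The canonical projection. -/
def proj (A : C) : reprMod A ⟶ I.quot A := reprHom (I.cls (𝟙 A))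

@[simp] lemma evalHom_proj {X A : C} (f : X ⟶ A) :
    evalHom (I.proj A) X (reprElem f) = I.cls f := by
  rw [proj, evalHom_reprHom, quot_res, Category.comp_id]

/-- The functoriality of the quotient. -/
def quotMap {A B : C} (f : A ⟶ B) : I.quot A ⟶ I.quot B :=
  ObjectProperty.homMk
    { app X := AddCommGrpCat.ofHom (QuotientAddGroup.map _ _ (Preadditive.rightComp X.unop f)
        fun _ hg => I.comp_right f hg)
      naturality X Y g := by
        ext x
        obtain ⟨x, rfl⟩ := QuotientAddGroup.mk'_surjective (I.T X.unop A) x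
        exact congrArg QuotientAddGroup.mk (Category.assoc g.unop x f) }

@[simp] lemma evalHom_quotMap {X A B : C} (f : A ⟶ B) (g : X ⟶ A) :
    evalHom (I.quotMap f) X (I.cls g) = I.cls (g ≫ f) := rfl

instance epi_proj (A : C) : Epi (I.proj A) := by
  refine Preadditive.epi_of_cancel_zero _ fun {K} g hg => hom_ext fun X x => ?_
  obtain ⟨f, rfl⟩ := I.cls_surjective x
  rw [← evalHom_proj, ← evalHom_comp, hg]
  simp

lemma reprMap_comp_proj {A B : C} (f : A ⟶ B) :
    reprMap f ≫ I.proj B = I.proj A ≫ I.quotMap f :=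
  reprMod_hom_ext (by simp)

end HomIdeal

end CatMod

/-! ### Categories of graded sums -/

/-- A preadditive category `E` is a realization of the graded morphism groups `Y` if its objects are
direct summands of finite direct sums of objects `h i A`, `i ∈ ℤ`, the morphisms
`h i A ⟶ h j B` being the morphisms of degree `j - i` from `A` to `B`. -/
structure Realization {A : Type u} [Category.{v} A] [Preadditive A] (Y : GradedHom.{w} A)
    (E : Type u') [Category.{v'} E] [Preadditive E] where
  h : ℤ → A → E
  Φ {i j : ℤ} {n : ℕ} (hij : i + n = j) {Z W : A} : Y.E Z W n ≃+ (h i Z ⟶ h j W)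
  Φ_comp {i j k : ℤ} {m n p : ℕ} (hij : i + m = j) (hjk : j + n = k) (hik : i + p = k)
    (hp : m + n = p) {Z W V : A} (α : Y.E Z W m) (β : Y.E W V n) :
    Φ hij α ≫ Φ hjk β = Φ hik (Y.comp hp α β)
  Φ_id (i : ℤ) (Z : A) : Φ (show i + (0 : ℕ) = i by simp) (Y.of (𝟙 Z)) = 𝟙 (h i Z)
  eq_zero {i j : ℤ} (hji : j < i) {Z W : A} (f : h i Z ⟶ h j W) : f = 0
  generates : IsAddGenerating fun p : ℤ × A => h p.1 p.2
  exists_sum (R : Type) [Fintype R] (i : R → ℤ) (Z : R → A) : ∃ (X : E)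
    (inj : ∀ r, h (i r) (Z r) ⟶ X) (pr : ∀ r, X ⟶ h (i r) (Z r)), (∀ r, inj r ≫ pr r = 𝟙 _) ∧
    (∀ r r', r ≠ r' → inj r ≫ pr r' = 0) ∧ ∑ r, pr r ≫ inj r = 𝟙 X

namespace Realization

section

variable {A : Type u} [Category.{v} A] [Preadditive A] {Y : GradedHom.{w} A}
  {E : Type u'} [Category.{v'} E] [Preadditive E] (ρ : Realization Y E)

/-- The opposite category is a realization of the opposite graded morphism groups. -/
def op : Realization Y.op Eᵒᵖ where
  h i Z := Opposite.op (ρ.h (-i) Z.unop)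
  Φ {i j n} hij Z W :=
    { (ρ.Φ (show -j + n = -i by lia)).toEquiv.trans (opEquiv _ _).symm with
      map_add' := fun a b => congrArg Quiver.Hom.op ((ρ.Φ _).map_add a b) }
  Φ_comp hij hjk hik hp Z W V α β :=
    congrArg Quiver.Hom.op (ρ.Φ_comp (by lia) (by lia) (by lia) (by lia) β α)
  Φ_id i Z := congrArg Quiver.Hom.op (ρ.Φ_id (-i) Z.unop)
  eq_zero hji Z W f := Quiver.Hom.unop_inj (ρ.eq_zero (by lia) f.unop)
  generates X := by
    obtain ⟨n, i, u, v, h⟩ := ρ.generates X.unop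
    -- The objects of index `- -i` and `i` are identified by the degree zero morphisms `e₁` and `e₂`
    -- belonging to the identity.
    let e₁ (r : Fin n) := ρ.Φ (show (i r).1 + (0 : ℕ) = - -(i r).1 by simp) (Y.of (𝟙 (i r).2))
    let e₂ (r : Fin n) := ρ.Φ (show - -(i r).1 + (0 : ℕ) = (i r).1 by simp) (Y.of (𝟙 (i r).2))
    have he (r : Fin n) : e₁ r ≫ e₂ r = 𝟙 _ := by
      rw [ρ.Φ_comp _ _ (show (i r).1 + (0 : ℕ) = (i r).1 by simp) (zero_add 0), Y.of_comp,
        Category.id_comp, ρ.Φ_id]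
    refine ⟨n, fun r => (-(i r).1, Opposite.op (i r).2), fun r => (e₂ r ≫ v r).op,
      fun r => (u r ≫ e₁ r).op, Quiver.Hom.unop_inj ?_⟩
    rw [unop_sum, unop_id, ← h]
    refine Finset.sum_congr rfl fun r _ => ?_
    change (u r ≫ e₁ r) ≫ e₂ r ≫ v r = _
    rw [Category.assoc, reassoc_of% he r]
  exists_sum R _ i Z := by
    obtain ⟨X, inj, pr, h₁, h₂, h₃⟩ := ρ.exists_sum R (fun r => -i r) (fun r => (Z r).unop)
    refine ⟨Opposite.op X, fun r => (pr r).op, fun r => (inj r).op,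
      fun r => congrArg Quiver.Hom.op (h₁ r),
      fun r r' h => congrArg Quiver.Hom.op (h₂ r' r h.symm), ?_⟩
    refine Quiver.Hom.unop_inj ?_
    rw [unop_sum]
    exact h₃

/-- The morphisms in degree zero. -/
def ofHom (i : ℤ) {Z W : A} (f : Z ⟶ W) : ρ.h i Z ⟶ ρ.h i W :=
  ρ.Φ (show i + (0 : ℕ) = i by simp) (Y.of f)

lemma ofHom_Φ {i j : ℤ} {n : ℕ} (hij : i + n = j) {Z W V : A} (f : Z ⟶ W) (α : Y.E W V n) :
    ρ.ofHom i f ≫ ρ.Φ hij α = ρ.Φ hij (Y.comp (zero_add n) (Y.of f) α) :=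
  ρ.Φ_comp _ _ _ _ _ _

lemma ofHom_comp (i : ℤ) {Z W V : A} (f : Z ⟶ W) (g : W ⟶ V) :
    ρ.ofHom i f ≫ ρ.ofHom i g = ρ.ofHom i (f ≫ g) := by
  rw [ofHom, ofHom, ρ.Φ_comp _ _ (show i + (0 : ℕ) = i by simp) (zero_add 0), Y.of_comp, ofHom]

lemma ofHom_eq_zero {i : ℤ} {Z W : A} {f : Z ⟶ W} (h : ρ.ofHom i f = 0) : f = 0 := by
  simpa [ofHom] using h

lemma exists_eq_ofHom {i : ℤ} {Z W : A} (f : ρ.h i Z ⟶ ρ.h i W) : ∃ g, f = ρ.ofHom i g := by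
  obtain ⟨α, rfl⟩ := (ρ.Φ (show i + (0 : ℕ) = i by simp)).surjective f
  obtain ⟨g, rfl⟩ := Y.of.surjective α
  exact ⟨g, rfl⟩

lemma exists_eq_Φ {i j : ℤ} (hij : i < j) {Z W : A} (f : ρ.h i Z ⟶ ρ.h j W) :
    ∃ (n : ℕ) (hn : i + (n + 1 : ℕ) = j) (α : Y.E Z W (n + 1)), f = ρ.Φ hn α := by
  obtain ⟨n, hn⟩ := Int.le.dest hij
  have hn' : i + (n + 1 : ℕ) = j := by push_cast; lia
  obtain ⟨α, rfl⟩ := (ρ.Φ hn').surjective f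
  exact ⟨n, hn', α, rfl⟩

/-- The ideal of morphisms of positive degree. -/
def ideal : HomIdeal E where
  T X X' :=
    -- Morphisms between objects of the same index `i` have degree zero, so this tests whether all
    -- degree zero components vanish, without choosing a decomposition of `X` and `X'`.
    { carrier := {f | ∀ (i : ℤ) (Z W : A) (a : ρ.h i Z ⟶ X) (b : X' ⟶ ρ.h i W), a ≫ f ≫ b = 0}
      zero_mem' := fun i Z W a b => by simp
      add_mem' := fun hf hg i Z W a b => by simp [hf i Z W a b, hg i Z W a b]
      neg_mem' := fun hf i Z W a b => by simp [hf i Z W a b] }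
  comp_left f g hg i Z W a b := by simpa using hg i Z W (a ≫ f) b
  comp_right g hf i Z W a b := by simpa using hf i Z W a (g ≫ b)

/-- A finite direct sum of objects `h i (Z i)` with different `i ∈ s`. -/
structure GradedSum where
  s : Finset ℤ
  Z : ℤ → A
  X : E
  inj (i : ℤ) : ρ.h i (Z i) ⟶ X
  pr (i : ℤ) : X ⟶ ρ.h i (Z i)
  inj_pr_self {i : ℤ} (hi : i ∈ s) : inj i ≫ pr i = 𝟙 _
  inj_pr_ne {i j : ℤ} (hij : i ≠ j) : inj i ≫ pr j = 0
  pr_eq_zero {i : ℤ} (hi : i ∉ s) : pr i = 0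
  total : ∑ i ∈ s, pr i ≫ inj i = 𝟙 X

lemma exists_eq_gradedSum (s : Finset ℤ) (Z : ℤ → A) : ∃ a : ρ.GradedSum, a.s = s ∧ a.Z = Z := by
  obtain ⟨X, inj, pr, h₁, h₂, h₃⟩ := ρ.exists_sum s (fun r => r) (fun r => Z r)
  refine ⟨{ s := s
            Z := Z
            X := X
            -- Outside the support the structure maps are zero by default, so that componentwise
            -- formulas can be stated for all `i`.
            inj i := if hi : i ∈ s then inj ⟨i, hi⟩ else 0
            pr i := if hi : i ∈ s then pr ⟨i, hi⟩ else 0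
            inj_pr_self {i} hi := by
              rw [dif_pos hi, dif_pos hi]
              exact h₁ ⟨i, hi⟩
            inj_pr_ne {i j} hij := by
              split_ifs with hi hj
              · exact h₂ ⟨i, hi⟩ ⟨j, hj⟩ (by simpa using hij)
              · exact comp_zero
              all_goals exact zero_comp
            pr_eq_zero hi := dif_neg hi
            total := by
              rw [← h₃, ← Finset.sum_coe_sort]
              exact Finset.sum_congr rfl fun i _ => by rw [dif_pos i.2, dif_pos i.2] }, rfl, rfl⟩

namespace GradedSum

variable {ρ} (a b : ρ.GradedSum)

lemma hom_ext {a : ρ.GradedSum} {W : E} {f g : W ⟶ a.X} (h : ∀ i, f ≫ a.pr i = g ≫ a.pr i) :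
    f = g := by
  rw [← Category.comp_id f, ← Category.comp_id g, ← a.total, Preadditive.comp_sum,
    Preadditive.comp_sum]
  exact Finset.sum_congr rfl fun i _ => by rw [reassoc_of% h i]

/-- Seen from an object of index `j`, only the component of index `j` has degree zero. Lower
components vanish, and higher ones cannot be brought back to a test object of index `m ≤ j`. -/
lemma mem_ideal_iff {j : ℤ} {W : A} (g : ρ.h j W ⟶ a.X) :
    g ∈ ρ.ideal.T _ _ ↔ g ≫ a.pr j = 0 := by
  refine ⟨fun h => by simpa using h j W _ (𝟙 _) (a.pr j), fun h m V V' x y => ?_⟩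
  rw [← Category.id_comp y, ← a.total, Preadditive.sum_comp, Preadditive.comp_sum,
    Preadditive.comp_sum]
  refine Finset.sum_eq_zero fun i _ => ?_
  by_cases hm : j < m
  · rw [ρ.eq_zero hm x, zero_comp]
  by_cases hi : i < j
  · have : g ≫ a.pr i = 0 := ρ.eq_zero hi _
    simp [reassoc_of% this]
  by_cases hij : i = j
  · subst hij
    simp [reassoc_of% h]
  · have : a.inj i ≫ y = 0 := ρ.eq_zero (by lia) _
    simp [this]

variable {a b} in
/-- The morphism with given homogeneous components. -/
def diag (τ : ℤ → ℤ) (θ : ∀ i, ρ.h i (a.Z i) ⟶ ρ.h (τ i) (b.Z (τ i))) : a.X ⟶ b.X :=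
  ∑ i ∈ a.s, a.pr i ≫ θ i ≫ b.inj (τ i)

variable {a b} in
lemma diag_pr {τ : ℤ → ℤ} (hτ : Function.Injective τ) (hs : ∀ i ∈ a.s, τ i ∈ b.s)
    (θ : ∀ i, ρ.h i (a.Z i) ⟶ ρ.h (τ i) (b.Z (τ i))) (i : ℤ) :
    diag τ θ ≫ b.pr (τ i) = a.pr i ≫ θ i := by
  rw [diag, Preadditive.sum_comp]
  have h : ∀ i', i' ≠ i → (a.pr i' ≫ θ i' ≫ b.inj (τ i')) ≫ b.pr (τ i) = 0 := fun i' hi' => by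
    rw [Category.assoc, Category.assoc, b.inj_pr_ne (fun h => hi' (hτ h)), comp_zero, comp_zero]
  by_cases hi : i ∈ a.s
  · rw [Finset.sum_eq_single i (fun i' _ => h i') (fun h => (h hi).elim), Category.assoc,
      Category.assoc, b.inj_pr_self (hs i hi), Category.comp_id]
  · rw [a.pr_eq_zero hi, zero_comp]
    exact Finset.sum_eq_zero fun i' hi' => h i' (by rintro rfl; exact hi hi')

end GradedSum

end

/-! ### Collecting homogeneous objects into graded sums -/

section

variable {A : Type u} [Category.{v} A] [Abelian A] {Y : GradedHom.{w} A}
  {E : Type u'} [Category.{v'} E] [Preadditive E] (ρ : Realization Y E)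

/-- Every finite family of homogeneous objects is a family of orthogonal retracts of a graded
sum. -/
lemma exists_gradedSum (R : Type) [Fintype R] (i : R → ℤ) (Z : R → A) : ∃ (a : ρ.GradedSum)
    (q : ∀ r, ρ.h (i r) (Z r) ⟶ a.X) (p : ∀ r, a.X ⟶ ρ.h (i r) (Z r)), (∀ r, q r ≫ p r = 𝟙 _) ∧
    (∀ r r', r ≠ r' → q r ≫ p r' = 0) := by
  classical
  have := Abelian.hasFiniteBiproducts (C := A)
  -- A graded sum has one object per index, so all `Z r` of index `j` are collected into a biproduct
  -- `B j` in `A`.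
  obtain ⟨B, ι, π, hι, hι'⟩ : ∃ (B : ℤ → A) (ι : ∀ r j, i r = j → (Z r ⟶ B j))
      (π : ∀ r j, i r = j → (B j ⟶ Z r)), (∀ r j h, ι r j h ≫ π r j h = 𝟙 _) ∧
      (∀ r r' j h h', r ≠ r' → ι r j h ≫ π r' j h' = 0) :=
    ⟨fun j => ⨁ fun r : {r // i r = j} => Z r.1,
      fun r j h => biproduct.ι (fun r : {r // i r = j} => Z r.1) ⟨r, h⟩,
      fun r j h => biproduct.π (fun r : {r // i r = j} => Z r.1) ⟨r, h⟩,
      fun r j h => biproduct.ι_π_self _ _,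
      fun r r' j h h' hr => biproduct.ι_π_ne _ (by simpa using hr)⟩
  obtain ⟨a, hs, rfl⟩ := ρ.exists_eq_gradedSum (Finset.univ.image i) B
  have hs (r) {j} (h : i r = j) : j ∈ a.s := by
    rw [hs, ← h]
    exact Finset.mem_image_of_mem _ (Finset.mem_univ _)
  let q : ∀ r j (h : i r = j), ρ.h (i r) (Z r) ⟶ a.X := fun r j h =>
    ρ.Φ (show i r + (0 : ℕ) = j by simpa using h) (Y.of (ι r j h)) ≫ a.inj j
  let p : ∀ r j (h : i r = j), a.X ⟶ ρ.h (i r) (Z r) := fun r j h =>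
    a.pr j ≫ ρ.Φ (show j + (0 : ℕ) = i r by simpa using h.symm) (Y.of (π r j h))
  have h₁ : ∀ r j h, q r j h ≫ p r j h = 𝟙 _ := fun r j h => by
    simp only [q, p, Category.assoc]
    rw [reassoc_of% a.inj_pr_self (hs r h),
      ρ.Φ_comp _ _ (show i r + (0 : ℕ) = i r by simp) (zero_add 0), Y.of_comp, hι, ρ.Φ_id]
  have h₂ : ∀ r j h r' j' h', r ≠ r' → q r j h ≫ p r' j' h' = 0 := fun r j h r' j' h' hr => by
    simp only [q, p, Category.assoc]
    by_cases hj : j = j'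
    · subst hj
      rw [reassoc_of% a.inj_pr_self (hs r h),
        ρ.Φ_comp _ _ (show i r + (0 : ℕ) = i r' by simp [h, h']) (zero_add 0), Y.of_comp,
        hι' _ _ _ _ _ hr, map_zero, map_zero]
    · rw [reassoc_of% a.inj_pr_ne hj, zero_comp, comp_zero]
  exact ⟨a, fun r => q r _ rfl, fun r => p r _ rfl, fun r => h₁ r _ rfl,
    fun r r' => h₂ r _ rfl r' _ rfl⟩

lemma exists_retract (X : E) : ∃ a : ρ.GradedSum, Nonempty (Retract X a.X) := by
  classical
  obtain ⟨n, i, u, v, h⟩ := ρ.generates X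
  obtain ⟨a, q, p, h₁, h₂⟩ := ρ.exists_gradedSum (Fin n) (fun r => (i r).1) (fun r => (i r).2)
  refine ⟨a, ⟨⟨∑ r, u r ≫ q r, ∑ r, p r ≫ v r, ?_⟩⟩⟩
  rw [Preadditive.sum_comp, ← h]
  refine Finset.sum_congr rfl fun r _ => ?_
  rw [Preadditive.comp_sum, Finset.sum_eq_single r (fun r' _ hr => by
    rw [Category.assoc, reassoc_of% h₂ r r' hr.symm, zero_comp, comp_zero]) (by simp),
    Category.assoc, reassoc_of% h₁ r]

lemma exists_gradedSum_sum (a b : ρ.GradedSum) : ∃ (c : ρ.GradedSum) (i₁ : a.X ⟶ c.X)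
    (i₂ : b.X ⟶ c.X) (p₁ : c.X ⟶ a.X) (p₂ : c.X ⟶ b.X), i₁ ≫ p₁ = 𝟙 _ ∧ i₂ ≫ p₂ = 𝟙 _ ∧
    i₁ ≫ p₂ = 0 ∧ i₂ ≫ p₁ = 0 := by
  classical
  obtain ⟨c, q, p, h₁, h₂⟩ := ρ.exists_gradedSum (a.s ⊕ b.s) (Sum.elim (fun i => i) fun i => i)
    (Sum.elim (fun i => a.Z i) fun i => b.Z i)
  have key (a b : ρ.GradedSum) (q : ∀ i : a.s, ρ.h i (a.Z i) ⟶ c.X)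
      (p : ∀ i : b.s, c.X ⟶ ρ.h i (b.Z i)) (h : ∀ i j, q i ≫ p j = 0) :
      (∑ i : a.s, a.pr i ≫ q i) ≫ (∑ i : b.s, p i ≫ b.inj i) = 0 := by
    simp_rw [Preadditive.sum_comp, Preadditive.comp_sum, Category.assoc, reassoc_of% h, zero_comp,
      comp_zero, Finset.sum_const_zero]
  have key' (a : ρ.GradedSum) (q : ∀ i : a.s, ρ.h i (a.Z i) ⟶ c.X)
      (p : ∀ i : a.s, c.X ⟶ ρ.h i (a.Z i)) (h : ∀ i, q i ≫ p i = 𝟙 _)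
      (h' : ∀ i j, i ≠ j → q i ≫ p j = 0) :
      (∑ i : a.s, a.pr i ≫ q i) ≫ (∑ i : a.s, p i ≫ a.inj i) = 𝟙 _ := by
    rw [← a.total, ← Finset.sum_coe_sort a.s fun i => a.pr i ≫ a.inj i, Preadditive.sum_comp]
    refine Finset.sum_congr rfl fun r _ => ?_
    rw [Preadditive.comp_sum, Finset.sum_eq_single r (fun r' _ hr => by
      rw [Category.assoc, reassoc_of% h' r r' hr.symm, zero_comp, comp_zero]) (by simp),
      Category.assoc, reassoc_of% h r]
  exact ⟨c, ∑ i : a.s, a.pr i ≫ q (Sum.inl i), ∑ i : b.s, b.pr i ≫ q (Sum.inr i),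
    ∑ i : a.s, p (Sum.inl i) ≫ a.inj i, ∑ i : b.s, p (Sum.inr i) ≫ b.inj i,
    key' a _ _ (fun i => h₁ (Sum.inl i)) fun i j hij => h₂ _ _ (by simpa using hij),
    key' b _ _ (fun i => h₁ (Sum.inr i)) fun i j hij => h₂ _ _ (by simpa using hij),
    key a b _ _ fun i j => h₂ (Sum.inl i) (Sum.inr j) (by simp),
    key b a _ _ fun i j => h₂ (Sum.inr i) (Sum.inl j) (by simp)⟩

end

end Realization

/-! ### Modules over a realization as a stratified family -/

namespace Realization

open CatMod

variable {A : Type u} [Category.{v} A] [Abelian A] {Y : GradedHom.{w} A}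
  {E : Type u'} [Category.{v'} E] [Preadditive E] {ρ : Realization Y E}

namespace GradedSum

lemma exists_lift (a : ρ.GradedSum) {W : E} (y : ∀ i, W ⟶ ρ.h i (a.Z i))
    (hy : ∀ i ∉ a.s, y i = 0) : ∃ z : W ⟶ a.X, ∀ i, z ≫ a.pr i = y i := by
  refine ⟨∑ i ∈ a.s, y i ≫ a.inj i, fun i => ?_⟩
  rw [Preadditive.sum_comp]
  have h : ∀ i', i' ≠ i → (y i' ≫ a.inj i') ≫ a.pr i = 0 := fun i' hi' => by
    rw [Category.assoc, a.inj_pr_ne hi', comp_zero]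
  by_cases hi : i ∈ a.s
  · rw [Finset.sum_eq_single i (fun i' _ => h i') (fun h => (h hi).elim), Category.assoc,
      a.inj_pr_self hi, Category.comp_id]
  · rw [hy i hi]
    exact Finset.sum_eq_zero fun i' hi' => h i' (by rintro rfl; exact hi hi')

lemma exists_lift_single (a : ρ.GradedSum) {W : E} {j : ℤ} (y : W ⟶ ρ.h j (a.Z j))
    (hy : j ∉ a.s → y = 0) : ∃ z : W ⟶ a.X, z ≫ a.pr j = y ∧ ∀ i ≠ j, z ≫ a.pr i = 0 := by
  by_cases hj : j ∈ a.s
  · refine ⟨y ≫ a.inj j, ?_, fun i hi => ?_⟩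
    · rw [Category.assoc, a.inj_pr_self hj, Category.comp_id]
    · rw [Category.assoc, a.inj_pr_ne hi.symm, comp_zero]
  · exact ⟨0, by rw [hy hj, zero_comp], fun i _ => zero_comp⟩

lemma cls_eq_zero (a : ρ.GradedSum) {j : ℤ} {W : A} (g : ρ.h j W ⟶ a.X) :
    ρ.ideal.cls g = 0 ↔ g ≫ a.pr j = 0 := by
  rw [HomIdeal.cls_eq_zero, mem_ideal_iff]

lemma cls_eq (a : ρ.GradedSum) {j : ℤ} {W : A} (g g' : ρ.h j W ⟶ a.X) :
    ρ.ideal.cls g = ρ.ideal.cls g' ↔ g ≫ a.pr j = g' ≫ a.pr j := by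
  rw [← sub_eq_zero, ← map_sub, cls_eq_zero, Preadditive.sub_comp, sub_eq_zero]

lemma diag_ofHom_pr {a b : ρ.GradedSum} (hs : a.s ⊆ b.s) (θ : ∀ i, a.Z i ⟶ b.Z i) (i : ℤ) :
    diag id (fun i => ρ.ofHom i (θ i)) ≫ b.pr i = a.pr i ≫ ρ.ofHom i (θ i) :=
  diag_pr Function.injective_id (fun _ hi => hs hi) _ i

/-- No morphism lowers the index, so a path from index `j` back to index `j` stays there: modulo the
ideal, `f` acts through its diagonal components. -/
lemma comp_pr_eq {a b : ρ.GradedSum} (f : b.X ⟶ a.X) {j : ℤ} {W : A} (g : ρ.h j W ⟶ b.X) :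
    (g ≫ f) ≫ a.pr j = g ≫ b.pr j ≫ b.inj j ≫ f ≫ a.pr j := by
  have h : ∀ i, i ≠ j → g ≫ (b.pr i ≫ b.inj i) ≫ f ≫ a.pr j = 0 := fun i hi => by
    obtain hi | hi := hi.lt_or_gt
    · have : g ≫ b.pr i = 0 := ρ.eq_zero hi _
      rw [Category.assoc, reassoc_of% this, zero_comp]
    · have : b.inj i ≫ f ≫ a.pr j = 0 := ρ.eq_zero hi _
      rw [Category.assoc, this, comp_zero, comp_zero]
  have hg : (g ≫ f) ≫ a.pr j = ∑ i ∈ b.s, g ≫ (b.pr i ≫ b.inj i) ≫ f ≫ a.pr j := by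
    rw [← Preadditive.comp_sum, ← Preadditive.sum_comp, b.total, Category.id_comp, Category.assoc]
  rw [hg]
  simp_rw [Category.assoc] at h ⊢
  by_cases hj : j ∈ b.s
  · exact Finset.sum_eq_single j (fun i _ => h i) fun h => (h hj).elim
  · rw [b.pr_eq_zero hj, zero_comp, comp_zero]
    exact Finset.sum_eq_zero fun i hi => h i (by rintro rfl; exact hj hi)

lemma mono_quotMap {a b : ρ.GradedSum} (hs : a.s ⊆ b.s) (θ : ∀ i, a.Z i ⟶ b.Z i)
    [∀ i, Mono (θ i)] : Mono (ρ.ideal.quotMap (diag id fun i => ρ.ofHom i (θ i))) := by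
  refine ρ.generates.mono_of_eval _ fun ⟨j, W⟩ x hx => ?_
  obtain ⟨g, rfl⟩ := ρ.ideal.cls_surjective x
  rw [HomIdeal.evalHom_quotMap, cls_eq_zero, Category.assoc, diag_ofHom_pr hs,
    ← Category.assoc] at hx
  rw [cls_eq_zero]
  obtain ⟨γ, hγ⟩ := ρ.exists_eq_ofHom (g ≫ a.pr j)
  rw [hγ, ofHom_comp] at hx
  rw [hγ, zero_of_comp_mono (θ j) (ρ.ofHom_eq_zero hx)]
  simp [ofHom]

/-- Modulo the ideal, `f` is a family of morphisms of `A`, one for each index, and the kernel is the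
graded sum of their kernels. -/
lemma exists_kernel {a b : ρ.GradedSum} (f : b.X ⟶ a.X) : ∃ (c : ρ.GradedSum) (m : c.X ⟶ b.X),
    Mono (ρ.ideal.quotMap m) ∧ ExactPair (ρ.ideal.quotMap m) (ρ.ideal.quotMap f) := by
  choose φ hφ using fun i => ρ.exists_eq_ofHom (b.inj i ≫ f ≫ a.pr i)
  obtain ⟨K, κ, _, hκ₀, hκ⟩ : ∃ (K : ℤ → A) (κ : ∀ i, K i ⟶ b.Z i), (∀ i, Mono (κ i)) ∧
      (∀ i, κ i ≫ φ i = 0) ∧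
      ∀ i (V : A) (g : V ⟶ b.Z i), g ≫ φ i = 0 → ∃ g', g' ≫ κ i = g :=
    ⟨fun i => kernel (φ i), fun i => kernel.ι (φ i), fun i => inferInstance,
      fun i => kernel.condition _, fun i V g hg => ⟨kernel.lift _ g hg, kernel.lift_ι _ _ _⟩⟩
  obtain ⟨c, hs, rfl⟩ := ρ.exists_eq_gradedSum b.s K
  refine ⟨c, diag id fun i => ρ.ofHom i (κ i), mono_quotMap hs.le κ, ?_⟩
  refine ρ.generates.exactPair_of_eval (fun ⟨j, W⟩ x => ?_) fun ⟨j, W⟩ x hx => ?_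
  · obtain ⟨g, rfl⟩ := ρ.ideal.cls_surjective x
    rw [HomIdeal.evalHom_quotMap, HomIdeal.evalHom_quotMap, cls_eq_zero, comp_pr_eq, hφ,
      Category.assoc, reassoc_of% diag_ofHom_pr hs.le κ j, ofHom_comp, hκ₀]
    simp [ofHom]
  · obtain ⟨g, rfl⟩ := ρ.ideal.cls_surjective x
    rw [HomIdeal.evalHom_quotMap, cls_eq_zero, comp_pr_eq, hφ, ← Category.assoc] at hx
    obtain ⟨γ, hγ⟩ := ρ.exists_eq_ofHom (g ≫ b.pr j)
    rw [hγ, ofHom_comp] at hx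
    obtain ⟨γ', rfl⟩ := hκ _ _ γ (ρ.ofHom_eq_zero hx)
    obtain ⟨z, hz, -⟩ := c.exists_lift_single (ρ.ofHom j γ') fun hj => by
      rw [hs] at hj
      rw [b.pr_eq_zero hj, comp_zero] at hγ
      rw [zero_of_comp_mono (κ j) (ρ.ofHom_eq_zero hγ.symm)]
      simp [ofHom]
    refine ⟨ρ.ideal.cls z, ?_⟩
    rw [HomIdeal.evalHom_quotMap, cls_eq, Category.assoc, diag_ofHom_pr hs.le κ, reassoc_of% hz,
      hγ, ofHom_comp]

end GradedSum

open GradedSum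

variable {R : ℕ → A → Prop} (hY : Y.IsResolving R)
include hY

/-- Objects of rank zero receive no morphisms of positive degree, so nothing is divided out. -/
lemma mono_proj {a : ρ.GradedSum} (h : ∀ i, R 0 (a.Z i)) : Mono (ρ.ideal.proj a.X) := by
  refine ρ.generates.mono_of_eval _ fun ⟨j, W⟩ x hx => ?_
  obtain ⟨g, rfl⟩ := reprElem.surjective x
  rw [HomIdeal.evalHom_proj, cls_eq_zero] at hx
  rw [map_eq_zero_iff _ reprElem.injective]
  refine GradedSum.hom_ext fun i => ?_
  rw [zero_comp]
  obtain hi | rfl | hi := lt_trichotomy i j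
  · exact ρ.eq_zero hi _
  · exact hx
  · obtain ⟨n, hn, α, hα⟩ := ρ.exists_eq_Φ hi (g ≫ a.pr i)
    rw [hα, hY.eq_zero (h i) _ α, map_zero]

/-- Assembles the resolutions of the components of `a`. As `η` has degree one, the resolution of
`a.Z (i + 1)` is placed at index `i`, and the supports are shifted by one. -/
lemma exists_resolution {n : ℕ} {a : ρ.GradedSum} (h : ∀ i, R (n + 1) (a.Z i)) :
    ∃ (a' c b : ρ.GradedSum) (j : ρ.ideal.quot a'.X ⟶ reprMod c.X) (p : reprMod c.X ⟶ reprMod b.X)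
      (q : reprMod b.X ⟶ reprMod a.X), (∀ i, R n (a'.Z i)) ∧ (∀ i, R n (b.Z i)) ∧ Mono j ∧
      ExactPair j p ∧ ExactPair p q ∧ ExactPair q (ρ.ideal.proj a.X) := by
  obtain ⟨X₁, X₂, X₃, f, g, η, _, hfg, hf, h₂, h₁, h₃, hη, ha₁, ha₂, ha₃⟩ :
      ∃ (X₁ X₂ X₃ : ℤ → A) (f : ∀ i, X₁ i ⟶ X₂ i) (g : ∀ i, X₂ i ⟶ X₃ i)
        (η : ∀ i, Y.E (X₃ i) (a.Z (i + 1)) 1), (∀ i, Mono (f i)) ∧ (∀ i, f i ≫ g i = 0) ∧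
        (∀ i (V : A) (x : V ⟶ X₂ i), x ≫ g i = 0 → ∃ y, y ≫ f i = x) ∧ (∀ i, R 0 (X₂ i)) ∧
        (∀ i, R n (X₁ i)) ∧ (∀ i, R n (X₃ i)) ∧
        (∀ i, Y.comp (zero_add 1) (Y.of (g i)) (η i) = 0) ∧
        (∀ i V m (α : Y.E V (a.Z (i + 1)) (m + 1)), ∃ β, Y.comp rfl β (η i) = α) ∧
        (∀ i V m (β : Y.E V (X₃ i) (m + 1)), Y.comp rfl β (η i) = 0 → β = 0) ∧
        (∀ i V (x : V ⟶ X₃ i), Y.comp (zero_add 1) (Y.of x) (η i) = 0 → ∃ y, y ≫ g i = x) := by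
    choose S hS η h using fun i => hY.exists_resolution (h (i + 1))
    exact ⟨fun i => (S i).X₁, fun i => (S i).X₂, fun i => (S i).X₃, fun i => (S i).f,
      fun i => (S i).g, η, fun i => (hS i).mono_f, fun i => (S i).zero,
      fun i V x hx => have := (hS i).mono_f
        ⟨(hS i).exact.lift x hx, (hS i).exact.lift_f x hx⟩, fun i => (h i).1,
      fun i => (h i).2.1, fun i => (h i).2.2.1, fun i => (h i).2.2.2.1,
      fun i => (h i).2.2.2.2.1, fun i => (h i).2.2.2.2.2.1, fun i => (h i).2.2.2.2.2.2⟩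
  obtain ⟨a', hs₁, rfl⟩ := ρ.exists_eq_gradedSum (a.s.image (· - 1)) X₁
  obtain ⟨c, hs₂, rfl⟩ := ρ.exists_eq_gradedSum (a.s.image (· - 1)) X₂
  obtain ⟨b, hs₃, rfl⟩ := ρ.exists_eq_gradedSum (a.s.image (· - 1)) X₃
  have hb (i : ℤ) : i ∈ b.s ↔ i + 1 ∈ a.s := by
    rw [hs₃, Finset.mem_image]
    exact ⟨fun ⟨j, hj, h⟩ => by rwa [← h, sub_add_cancel], fun h => ⟨_, h, by simp⟩⟩
  have h₁₂ : a'.s ⊆ c.s := (hs₁.trans hs₂.symm).le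
  have h₂₃ : c.s ⊆ b.s := (hs₂.trans hs₃.symm).le
  let ι : a'.X ⟶ c.X := diag id fun i => ρ.ofHom i (f i)
  let p : c.X ⟶ b.X := diag id fun i => ρ.ofHom i (g i)
  let q : b.X ⟶ a.X := diag (· + 1) fun i => ρ.Φ (n := 1) rfl (η i)
  have hι (i : ℤ) : ι ≫ c.pr i = a'.pr i ≫ ρ.ofHom i (f i) := diag_ofHom_pr h₁₂ f i
  have hp (i : ℤ) : p ≫ b.pr i = c.pr i ≫ ρ.ofHom i (g i) := diag_ofHom_pr h₂₃ g i
  have hq (i : ℤ) : q ≫ a.pr (i + 1) = b.pr i ≫ ρ.Φ (n := 1) rfl (η i) :=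
    diag_pr (add_left_injective 1) (fun i hi => (hb i).1 hi) _ i
  have hιp : ι ≫ p = 0 := GradedSum.hom_ext fun i => by
    rw [Category.assoc, hp, reassoc_of% hι, ofHom_comp, hfg]
    simp [ofHom]
  have hpq : p ≫ q = 0 := GradedSum.hom_ext fun i => by
    obtain ⟨i, rfl⟩ : ∃ i', i = i' + 1 := ⟨i - 1, by simp⟩
    rw [Category.assoc, hq, reassoc_of% hp, ofHom_Φ, hη, map_zero, comp_zero, zero_comp]
  have : Mono (ρ.ideal.proj c.X) := mono_proj hY h₂
  -- The middle terms have rank zero, so `P = S` for `c`; the inverse turns the map of quotients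
  -- induced by `ι` into a map to `reprMod c.X`.
  have : IsIso (ρ.ideal.proj c.X) := isIso_of_mono_of_epi _
  have hinv {W : E} (x : W ⟶ c.X) :
      evalHom (inv (ρ.ideal.proj c.X)) W (ρ.ideal.cls x) = reprElem x := by
    rw [← HomIdeal.evalHom_proj, ← evalHom_comp, IsIso.hom_inv_id, evalHom_id]
  have : Mono (ρ.ideal.quotMap ι) := mono_quotMap h₁₂ f
  refine ⟨a', c, b, ρ.ideal.quotMap ι ≫ inv (ρ.ideal.proj c.X), reprMap p, reprMap q, h₁, h₃,
    inferInstance, ?_, ?_, ?_⟩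
  · refine ρ.generates.exactPair_of_eval (fun ⟨j, W⟩ x => ?_) fun ⟨j, W⟩ x hx => ?_
    · obtain ⟨x, rfl⟩ := ρ.ideal.cls_surjective x
      rw [evalHom_comp, HomIdeal.evalHom_quotMap, hinv, evalHom_reprMap, Category.assoc, hιp,
        comp_zero, map_zero]
    · obtain ⟨x, rfl⟩ := reprElem.surjective x
      rw [evalHom_reprMap, map_eq_zero_iff _ reprElem.injective] at hx
      have hx' := x ≫= hp j
      rw [reassoc_of% hx, zero_comp] at hx'
      obtain ⟨γ, hγ⟩ := ρ.exists_eq_ofHom (x ≫ c.pr j)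
      rw [reassoc_of% hγ, ofHom_comp] at hx'
      obtain ⟨γ', rfl⟩ := hf _ _ _ (ρ.ofHom_eq_zero hx'.symm)
      obtain ⟨z, hz, -⟩ := a'.exists_lift_single (ρ.ofHom j γ') fun hj => by
        rw [hs₁, ← hs₂] at hj
        rw [c.pr_eq_zero hj, comp_zero] at hγ
        rw [zero_of_comp_mono (f j) (ρ.ofHom_eq_zero hγ.symm)]
        simp [ofHom]
      refine ⟨ρ.ideal.cls z, evalHom_injective (ρ.ideal.proj c.X) _ ?_⟩
      rw [← evalHom_comp, Category.assoc, IsIso.inv_hom_id, Category.comp_id,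
        HomIdeal.evalHom_quotMap, HomIdeal.evalHom_proj, GradedSum.cls_eq, Category.assoc, hι,
        reassoc_of% hz, hγ, ofHom_comp]
  · refine ρ.generates.exactPair_of_eval (fun ⟨j, W⟩ x => ?_) fun ⟨j, W⟩ x hx => ?_
    · obtain ⟨x, rfl⟩ := reprElem.surjective x
      rw [evalHom_reprMap, evalHom_reprMap, Category.assoc, hpq, comp_zero, map_zero]
    · obtain ⟨x, rfl⟩ := reprElem.surjective x
      rw [evalHom_reprMap, map_eq_zero_iff _ reprElem.injective] at hx
      have hx' (i : ℤ) : (x ≫ b.pr i) ≫ ρ.Φ (n := 1) rfl (η i) = 0 := by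
        rw [Category.assoc, ← hq, reassoc_of% hx, zero_comp]
      -- Multiplication by `η` is injective in positive degrees, so a morphism killed by `q` is
      -- concentrated in degree zero. There it lifts through `g`.
      have hne (i : ℤ) (hi : i ≠ j) : x ≫ b.pr i = 0 := by
        obtain hi | hi := hi.lt_or_gt
        · exact ρ.eq_zero hi _
        · obtain ⟨m, hm, β, hβ⟩ := ρ.exists_eq_Φ hi (x ≫ b.pr i)
          have := hx' i
          rw [hβ, ρ.Φ_comp _ _ (show j + (m + 1 + 1 : ℕ) = i + 1 by push_cast at hm ⊢; lia) rfl,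
            map_eq_zero_iff _ (AddEquiv.injective _)] at this
          rw [hβ, ha₂ _ _ _ _ this, map_zero]
      obtain ⟨γ, hγ⟩ := ρ.exists_eq_ofHom (x ≫ b.pr j)
      have := hx' j
      rw [hγ, ofHom_Φ, map_eq_zero_iff _ (AddEquiv.injective _)] at this
      obtain ⟨γ', rfl⟩ := ha₃ _ _ _ this
      obtain ⟨z, hz, hz'⟩ : ∃ z : ρ.h j W ⟶ c.X, (z ≫ p) ≫ b.pr j = x ≫ b.pr j ∧
          ∀ i ≠ j, z ≫ c.pr i = 0 := by
        by_cases hj : j ∈ c.s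
        · obtain ⟨z, hz, hz'⟩ := c.exists_lift_single (ρ.ofHom j γ') fun h => (h hj).elim
          exact ⟨z, by rw [Category.assoc, hp, reassoc_of% hz, ofHom_comp, hγ], hz'⟩
        · rw [hs₂, ← hs₃] at hj
          exact ⟨0, by rw [b.pr_eq_zero hj, comp_zero, comp_zero], fun _ _ => zero_comp⟩
      refine ⟨reprElem z, ?_⟩
      rw [evalHom_reprMap]
      refine congrArg _ (GradedSum.hom_ext fun i => ?_)
      by_cases hi : i = j
      · subst hi
        exact hz
      · rw [hne i hi, Category.assoc, hp, reassoc_of% hz' i hi, zero_comp]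
  · refine ρ.generates.exactPair_of_eval (fun ⟨j, W⟩ x => ?_) fun ⟨j, W⟩ x hx => ?_
    · obtain ⟨x, rfl⟩ := reprElem.surjective x
      rw [evalHom_reprMap, HomIdeal.evalHom_proj, cls_eq_zero]
      obtain ⟨j, rfl⟩ : ∃ j', j = j' + 1 := ⟨j - 1, by simp⟩
      have : x ≫ b.pr j = 0 := ρ.eq_zero (by lia) _
      rw [Category.assoc, hq, reassoc_of% this, zero_comp]
    · obtain ⟨x, rfl⟩ := reprElem.surjective x
      rw [HomIdeal.evalHom_proj, cls_eq_zero] at hx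
      have key (i : ℤ) : ∃ y : ρ.h j W ⟶ ρ.h i (b.Z i),
          y ≫ ρ.Φ (n := 1) rfl (η i) = x ≫ a.pr (i + 1) ∧ (i ∉ b.s → y = 0) := by
        by_cases hi : i ∉ b.s
        · rw [hb] at hi
          exact ⟨0, by rw [zero_comp, a.pr_eq_zero hi, comp_zero], fun _ => rfl⟩
        simp only [hi, false_imp_iff, and_true]
        -- The component at `i + 1` vanishes below `j` for reasons of degree and at `j` because `x`
        -- lies in the ideal; above `j` it has positive degree and is a multiple of `η`.
        obtain hi | rfl | hi := lt_trichotomy (i + 1) j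
        · exact ⟨0, by rw [zero_comp, ρ.eq_zero hi (x ≫ _)]⟩
        · exact ⟨0, by rw [zero_comp, hx]⟩
        · obtain ⟨m, hm, α, hα⟩ := ρ.exists_eq_Φ hi (x ≫ a.pr (i + 1))
          obtain ⟨β, rfl⟩ := ha₁ _ _ _ α
          exact ⟨ρ.Φ (show j + (m : ℕ) = i by push_cast at hm; lia) β, by
            rw [hα, ρ.Φ_comp _ _ hm rfl]⟩
      choose y hy hy' using key
      obtain ⟨z, hz⟩ := b.exists_lift y hy'
      refine ⟨reprElem z, ?_⟩
      rw [evalHom_reprMap]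
      refine congrArg _ (GradedSum.hom_ext fun i => ?_)
      obtain ⟨i, rfl⟩ : ∃ i', i = i' + 1 := ⟨i - 1, by simp⟩
      rw [Category.assoc, hq, reassoc_of% hz, hy]

/-- The stratification of the modules over a realization. -/
def stratification (ρ : Realization Y E) : Stratification (CatMod E) ρ.GradedSum where
  P a := reprMod a.X
  S a := ρ.ideal.quot a.X
  π a := ρ.ideal.proj a.X
  epi_π a := inferInstance
  proj a := inferInstance
  R n a := ∀ i, R n (a.Z i)
  exists_sum a b := by
    obtain ⟨c, i₁, i₂, p₁, p₂, h₁, h₂, h₃, h₄⟩ := ρ.exists_gradedSum_sum a b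
    refine ⟨c, biprod.lift (reprMap p₁) (reprMap p₂), ?_⟩
    have : biprod.desc (reprMap i₁) (reprMap i₂) ≫ biprod.lift (reprMap p₁) (reprMap p₂) =
        𝟙 _ := by
      apply biprod.hom_ext' <;> apply biprod.hom_ext <;>
        simp [reprMap_comp, reprMap_id, h₁, h₂, h₃, h₄]
    have : Epi (biprod.desc (reprMap i₁) (reprMap i₂) ≫
      biprod.lift (reprMap p₁) (reprMap p₂)) := by rw [this]; infer_instance
    exact epi_of_epi (biprod.desc (reprMap i₁) (reprMap i₂)) _
  exists_kernel f := by
    obtain ⟨f, rfl⟩ := exists_eq_reprMap f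
    obtain ⟨c, m, h₁, h₂⟩ := GradedSum.exists_kernel f
    exact ⟨c, reprMap m, _, _, ρ.ideal.reprMap_comp_proj m, ρ.ideal.reprMap_comp_proj f, h₁, h₂⟩
  mono_π h := mono_proj hY h
  exists_resolution h := exists_resolution hY h

variable {N : ℕ} (hN : ∀ Z, R N Z)
include hN

lemma hasWeakKernels (ρ : Realization Y E) : HasWeakKernels E where
  hasWeakLimit {X Z} f := by
    obtain ⟨a, ⟨ra⟩⟩ := ρ.exists_retract Z
    obtain ⟨b, ⟨rb⟩⟩ := ρ.exists_retract X
    obtain ⟨c, m, hm⟩ := (stratification hY ρ).exists_cover_kernel_of_retract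
      (fun _ _ => hN _) (reprRetract ra) (reprRetract rb) (reprMap f)
    exact hasWeakKernel_of_exactPair f m hm

/-- Representables are retracts of the projectives of the stratification, so a presentation of the
first argument `X` bounds its projective dimension. -/
lemma leftGlobalDim_le (ρ : Realization Y E) :
    leftGlobalDim E ≤ ((3 * N + 2 : ℕ) : WithBot ℕ∞) := by
  refine sSup_le ?_
  rintro _ ⟨n, X, Z, rfl, ⟨X₀, X₁, f, p, w, hf, _⟩, -, hn⟩
  obtain ⟨a, ⟨ra⟩⟩ := ρ.exists_retract X₀
  obtain ⟨b, ⟨rb⟩⟩ := ρ.exists_retract X₁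
  have : Epi (X := (stratification hY ρ).P b) (reprRetract rb).r := (reprRetract rb).splitEpi.epi
  have h := (stratification hY ρ).dim_of_presentation (fun _ _ => hN _) (reprRetract ra)
    (reprRetract rb).r f p ⟨w, hf⟩
  by_contra hn'
  refine not_subsingleton_iff_nontrivial.2 hn
    (h.subsingleton' n (not_lt.1 fun h => hn' ?_) (Y := Z))
  exact_mod_cast Nat.le_of_lt_succ h

end Realization

/-! ### Shifted morphisms -/

namespace CategoryTheory.ShiftedHom

section

variable {D : Type u} [Category.{v} D] [Preadditive D] [HasShift D ℤ]
  [∀ n : ℤ, (shiftFunctor D n).Additive]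

/-- The morphisms `X⟦i⟧ ⟶ Y⟦j⟧` as shifted morphisms of degree `j - i`. -/
noncomputable def shiftAddEquiv {n i j : ℤ} (h : n + i = j) (X Y : D) :
    ShiftedHom X Y n ≃+ (X⟦i⟧ ⟶ Y⟦j⟧) :=
  AddEquiv.mk' (((Functor.FullyFaithful.ofFullyFaithful (shiftFunctor D i)).homEquiv).trans
    ((shiftFunctorAdd' D n i j h).symm.app Y).homToEquiv) fun f g => by
      simp [Functor.FullyFaithful.homEquiv, Functor.map_add]

lemma shiftAddEquiv_apply {n i j : ℤ} (h : n + i = j) {X Y : D} (f : ShiftedHom X Y n) :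
    shiftAddEquiv h X Y f = f⟦i⟧' ≫ (shiftFunctorAdd' D n i j h).inv.app Y := rfl

lemma shiftAddEquiv_comp {m n p i j k : ℤ} (hij : m + i = j) (hjk : n + j = k) (hik : p + i = k)
    (hp : n + m = p) {X Y Z : D} (f : ShiftedHom X Y m) (g : ShiftedHom Y Z n) :
    shiftAddEquiv hij X Y f ≫ shiftAddEquiv hjk Y Z g = shiftAddEquiv hik X Z (f.comp g hp) := by
  simp only [shiftAddEquiv_apply, comp, Functor.map_comp, Category.assoc]
  rw [← NatTrans.naturality_assoc,
    shiftFunctorAdd'_assoc_inv_app n m i p j k hp hij (by lia)]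
  rfl

lemma shiftAddEquiv_mk₀_id {n i : ℤ} (hn : n = 0) (X : D) :
    shiftAddEquiv (show n + i = i by rw [hn, zero_add]) X X (mk₀ n hn (𝟙 X)) = 𝟙 _ := by
  subst hn
  rw [shiftAddEquiv_apply, mk₀, Category.id_comp, shiftFunctorAdd'_zero_add_inv_app,
    ← Functor.map_comp]
  simp [shiftFunctorZero']

end

section

variable {D : Type u} [Category.{v} D] [Preadditive D] [HasShift D ℤ]
  {D' : Type u'} [Category.{v'} D'] [Preadditive D'] [HasShift D' ℤ]

/-- A fully faithful functor which commutes with the shift is bijective on shifted morphisms. -/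
noncomputable def mapAddEquiv (F : D ⥤ D') [F.CommShift ℤ] [F.Additive] [F.Full] [F.Faithful]
    (X Y : D) (n : ℤ) : ShiftedHom X Y n ≃+ ShiftedHom (F.obj X) (F.obj Y) n :=
  AddEquiv.mk' (((Functor.FullyFaithful.ofFullyFaithful F).homEquiv).trans
    ((F.commShiftIso n).app Y).homToEquiv) fun f g => by
      simp [Functor.FullyFaithful.homEquiv, Functor.map_add]

lemma mapAddEquiv_apply (F : D ⥤ D') [F.CommShift ℤ] [F.Additive] [F.Full] [F.Faithful]
    {X Y : D} {n : ℤ} (f : ShiftedHom X Y n) : mapAddEquiv F X Y n f = f.map F := rfl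

end

end CategoryTheory.ShiftedHom

/-! ### The Veronese category as a realization -/

section VeroneseCat

open Abelian

variable (k : Type t) (Λ : Type u) [Field k] [Ring Λ] [Algebra k Λ] [FiniteDimensional k Λ]
  [HasDerivedCategory.{w} (FinMod k Λ)]

/-- The extension groups of modules, as shifted morphisms in the derived category. -/
noncomputable def extDerivedEquiv (A B : FinMod k Λ) (n : ℕ) : Ext A B n ≃+
    ShiftedHom (DerivedCategory.Bounded.ι.obj (stalk k Λ A))
      (DerivedCategory.Bounded.ι.obj (stalk k Λ B)) (n : ℤ) :=
  Ext.homAddEquiv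

/-- The extension groups of modules, as shifted morphisms between stalk complexes. -/
noncomputable def extStalkEquiv (A B : FinMod k Λ) (n : ℕ) :
    Ext A B n ≃+ ShiftedHom (stalk k Λ A) (stalk k Λ B) (n : ℤ) :=
  (extDerivedEquiv k Λ A B n).trans
    (ShiftedHom.mapAddEquiv DerivedCategory.Bounded.ι (stalk k Λ A) (stalk k Λ B) (n : ℤ)).symm

variable {k Λ}

lemma extStalkEquiv_map {A B : FinMod k Λ} {n : ℕ} (α : Ext A B n) :
    (extStalkEquiv k Λ A B n α).map DerivedCategory.Bounded.ι = extDerivedEquiv k Λ A B n α :=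
  (ShiftedHom.mapAddEquiv DerivedCategory.Bounded.ι (stalk k Λ A) (stalk k Λ B)
    (n : ℤ)).apply_symm_apply
    (extDerivedEquiv k Λ A B n α)

lemma extStalkEquiv_comp {A B C : FinMod k Λ} {m n p : ℕ} (h : m + n = p) (α : Ext A B m)
    (β : Ext B C n) : extStalkEquiv k Λ A C p (α.comp β h) =
      (extStalkEquiv k Λ A B m α).comp (extStalkEquiv k Λ B C n β) (by lia) := by
  refine (ShiftedHom.mapAddEquiv DerivedCategory.Bounded.ι _ _ _).injective ?_
  rw [ShiftedHom.mapAddEquiv_apply, ShiftedHom.mapAddEquiv_apply, ShiftedHom.map_comp]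
  simp only [extStalkEquiv_map]
  exact Ext.comp_hom α β h

lemma extStalkEquiv_mk₀_id (A : FinMod k Λ) : extStalkEquiv k Λ A A 0 (Ext.mk₀ (𝟙 A)) =
    ShiftedHom.mk₀ _ Nat.cast_zero (𝟙 _) := by
  refine (ShiftedHom.mapAddEquiv DerivedCategory.Bounded.ι _ _ _).injective ?_
  rw [ShiftedHom.mapAddEquiv_apply, ShiftedHom.mapAddEquiv_apply, ShiftedHom.map_mk₀,
    extStalkEquiv_map, CategoryTheory.Functor.map_id]
  exact (Ext.mk₀_hom (𝟙 A)).trans (congrArg _ (CategoryTheory.Functor.map_id _ _))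

/-- The shifts of stalk complexes, as objects of the Veronese category. -/
noncomputable def shiftedStalk (l : ℕ) (i : ℤ) (A : FinMod k Λ) : VeroneseCat k Λ l :=
  ⟨(stalk k Λ A)⟦i * (l : ℤ)⟧, 1, fun _ => (stalk k Λ A)⟦i * (l : ℤ)⟧,
    (limitBiconeOfUnique _).bicone,
    fun _ => ⟨A, i, rfl⟩, ⟨limitBiconeOfUnique _ |>.isBilimit⟩, ⟨Retract.refl _⟩⟩

/-- The morphisms in a full subcategory. -/
def CategoryTheory.ObjectProperty.fullSubcategoryHomAddEquiv {D : Type u} [Category.{v} D]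
    [Preadditive D] {P : ObjectProperty D} (X Y : P.FullSubcategory) :
    (X ⟶ Y) ≃+ (X.obj ⟶ Y.obj) :=
  AddEquiv.mk' P.fullyFaithfulι.homEquiv fun _ _ => rfl

/-- Vanishing of negative extensions: the source lives in cohomological degree `-il`, strictly below
the degree `-jl` of the target, and the t-structure applies. -/
lemma shiftedStalk_hom_eq_zero {l : ℕ} (hl : 0 < l) {i j : ℤ} (hji : j < i) {A B : FinMod k Λ}
    (f : shiftedStalk l i A ⟶ shiftedStalk l j B) : f = 0 := by
  refine (ObjectProperty.fullSubcategoryHomAddEquiv _ _).injective ?_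
  rw [map_zero]
  have h (m : ℤ) (A : FinMod k Λ) : DerivedCategory.TStructure.t.IsLE
      (DerivedCategory.Bounded.ι.obj ((stalk k Λ A)⟦m⟧)) (-m) ∧ DerivedCategory.TStructure.t.IsGE
      (DerivedCategory.Bounded.ι.obj ((stalk k Λ A)⟦m⟧)) (-m) := by
    have e := (DerivedCategory.Bounded.ι.commShiftIso m).symm.app (stalk k Λ A)
    have h₁ := DerivedCategory.TStructure.t.isLE_shift
      ((DerivedCategory.singleFunctor (FinMod k Λ) 0).obj A) 0 m (-m) (by lia)
    have h₂ := DerivedCategory.TStructure.t.isGE_shift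
      ((DerivedCategory.singleFunctor (FinMod k Λ) 0).obj A) 0 m (-m) (by lia)
    exact ⟨@Triangulated.TStructure.isLE_of_iso _ _ _ _ _ _ _ _ _ _ e _ h₁,
      @Triangulated.TStructure.isGE_of_iso _ _ _ _ _ _ _ _ _ _ e _ h₂⟩
  refine DerivedCategory.Bounded.ι.map_injective ?_
  rw [Functor.map_zero]
  refine DerivedCategory.TStructure.t.zero_of_isLE_of_isGE _ (-(i * (l : ℤ))) (-(j * (l : ℤ))) ?_
    (h _ A).1 (h _ B).2
  have : (0 : ℤ) < l := by exact_mod_cast hl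
  nlinarith

/-- The Veronese category is a realization of the extension groups in degrees divisible by `l`. -/
noncomputable def veroneseRealization {l : ℕ} (hl : 0 < l) :
    Realization (Ext.veronese (FinMod k Λ) l) (VeroneseCat k Λ l) where
  h i A := shiftedStalk l i A
  Φ {i j n} hij Z W := ((extStalkEquiv k Λ Z W (l * n)).trans (ShiftedHom.shiftAddEquiv
      (show ((l * n : ℕ) : ℤ) + i * l = j * l by rw [← hij]; push_cast; ring) _ _)).trans
    (ObjectProperty.fullSubcategoryHomAddEquiv (shiftedStalk l i Z) (shiftedStalk l j W)).symm
  Φ_comp {i j r m n p} hij hjk hik hp Z W V α β := by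
    refine (ObjectProperty.fullSubcategoryHomAddEquiv _ _).injective ?_
    have hik' : ((l * p : ℕ) : ℤ) + i * l = r * l := by rw [← hik]; push_cast; ring
    have hp' : ((l * n : ℕ) : ℤ) + ((l * m : ℕ) : ℤ) = ((l * p : ℕ) : ℤ) := by
      rw [← hp]; push_cast; ring
    refine (ShiftedHom.shiftAddEquiv_comp _ _ hik' hp' (extStalkEquiv k Λ Z W (l * m) α)
      (extStalkEquiv k Λ W V (l * n) β)).trans ?_
    exact congrArg (ShiftedHom.shiftAddEquiv hik' (stalk k Λ Z) (stalk k Λ V))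
      (extStalkEquiv_comp (by rw [← hp, mul_add]) α β).symm
  Φ_id i Z := by
    refine (ObjectProperty.fullSubcategoryHomAddEquiv _ _).injective ?_
    refine Eq.trans ?_ (ShiftedHom.shiftAddEquiv_mk₀_id (Nat.cast_zero) _)
    exact congrArg (ShiftedHom.shiftAddEquiv (by simp) (stalk k Λ Z) (stalk k Λ Z))
      (extStalkEquiv_mk₀_id Z)
  eq_zero hji Z W f := shiftedStalk_hom_eq_zero hl hji f
  generates X := by
    obtain ⟨n, Y, b, hY, ⟨hb⟩, ⟨r⟩⟩ := X.property
    choose A i hA using hY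
    refine ⟨n, fun j => (i j, A j),
      fun j => ObjectProperty.homMk (r.i ≫ b.π j ≫ eqToHom (hA j)),
      fun j => ObjectProperty.homMk (eqToHom (hA j).symm ≫ b.ι j ≫ r.r), ?_⟩
    refine (ObjectProperty.fullSubcategoryHomAddEquiv _ _).injective ?_
    rw [map_sum]
    refine Eq.trans ?_ r.retract
    have := r.i ≫= IsBilimit.total hb =≫ r.r
    rw [Category.id_comp] at this
    rw [← this, Preadditive.sum_comp, Preadditive.comp_sum]
    refine Finset.sum_congr rfl fun j _ => ?_
    change (r.i ≫ b.π j ≫ eqToHom (hA j)) ≫ (eqToHom (hA j).symm ≫ b.ι j ≫ r.r) = _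
    simp
  exists_sum R _ i Z := by
    classical
    have : HasFiniteBiproducts (DerivedCategory.Bounded (FinMod k Λ)) :=
      HasFiniteBiproducts.of_hasFiniteProducts
    let Y (r : R) : DerivedCategory.Bounded (FinMod k Λ) := (stalk k Λ (Z r))⟦i r * (l : ℤ)⟧
    let e := Fintype.equivFin R
    refine ⟨⟨⨁ Y, _, Y ∘ e.symm, (biproduct.bicone Y).whisker e.symm, fun j => ⟨_, _, rfl⟩,
      ⟨(Bicone.whiskerIsBilimitIff _ _).2 (biproduct.isBilimit Y)⟩, ⟨Retract.refl _⟩⟩,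
      fun r => ObjectProperty.homMk (biproduct.ι Y r),
      fun r => ObjectProperty.homMk (biproduct.π Y r), fun r => ?_, fun r r' h => ?_, ?_⟩
    · exact ObjectProperty.hom_ext _ (biproduct.ι_π_self Y r)
    · exact ObjectProperty.hom_ext _ (biproduct.ι_π_ne Y h)
    · refine (ObjectProperty.fullSubcategoryHomAddEquiv _ _).injective ?_
      rw [map_sum]
      exact IsBilimit.total (biproduct.isBilimit Y)

end VeroneseCat

/-! ### The global dimension of a ring and its cyclic modules -/

section RingGlobalDim

open Abelian

lemma ModuleCat.exactPair_of_exact {R : Type u} [Ring R] {X Y Z : ModuleCat.{v} R} {f : X ⟶ Y}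
    {g : Y ⟶ Z} (w : ∀ x, g (f x) = 0) (h : ∀ y, g y = 0 → ∃ x, f x = y) : ExactPair f g := by
  have w' : f ≫ g = 0 := by
    ext x
    exact w x
  exact ⟨w', (ShortComplex.moduleCat_exact_iff _).2 h⟩

variable {R : Type u} [Ring R]

/-- For `n = 0`, vanishing of `Ext^1(R/I, X)` extends every map `I → X` to `R`, which is Baer's
criterion; larger `n` are reduced to this by passing to cosyzygies. -/
lemma hasInjectiveDimensionLT_of_cyclic (n : ℕ) (X : ModuleCat.{u} R)
    (h : ∀ (I : Ideal R) (e : Ext (ModuleCat.of R (R ⧸ I)) X (n + 1)), e = 0) :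
    HasInjectiveDimensionLT X (n + 1) := by
  induction n generalizing X with
  | zero =>
    rw [← injective_iff_hasInjectiveDimensionLT_one, ← Module.injective_iff_injective_object,
      ← Module.Baer.iff_injective]
    intro I g
    let S : ShortComplex (ModuleCat.{u} R) := ShortComplex.mk (ModuleCat.ofHom I.subtype)
      (ModuleCat.ofHom I.mkQ) (by
        ext x
        exact (Submodule.Quotient.mk_eq_zero I).2 x.2)
    have hS : S.ShortExact :=
      { exact := (ShortComplex.moduleCat_exact_iff _).2 fun x hx =>
          ⟨⟨x, (Submodule.Quotient.mk_eq_zero I).1 hx⟩, rfl⟩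
        mono_f := (ModuleCat.mono_iff_injective _).2 I.subtype_injective
        epi_g := (ModuleCat.epi_iff_surjective _).2 I.mkQ_surjective }
    obtain ⟨g', hg'⟩ := Ext.contravariant_sequence_exact₁ hS X (Ext.mk₀ (ModuleCat.ofHom g))
      (add_zero 1) (h I _)
    obtain ⟨g', rfl⟩ := (Ext.mk₀_bijective _ _).2 g'
    rw [Ext.mk₀_comp_mk₀] at hg'
    have := (Ext.mk₀_bijective _ _).1 hg'
    exact ⟨g'.hom, fun x hx => ConcreteCategory.congr_hom this (⟨x, hx⟩ : I)⟩
  | succ n ih =>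
    obtain ⟨J⟩ := EnoughInjectives.presentation X
    have hS : (ShortComplex.mk _ _ (cokernel.condition J.f)).ShortExact :=
      { exact := ShortComplex.exact_cokernel J.f }
    have : Injective J.J := J.injective
    refine (hS.hasInjectiveDimensionLT_X₃_iff n this).1 (ih _ fun I e => ?_)
    obtain ⟨e', rfl⟩ := Ext.covariant_sequence_exact₃ _ hS e rfl (h I _)
    rw [Ext.eq_zero_of_injective e', Ext.zero_comp]

/-- Auslander's reduction: bounds on cyclic modules bound all injective dimensions, hence make `Ext`
vanish in both arguments. -/
lemma ringGlobalDim_le_of_cyclic (n : ℕ)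
    (h : ∀ I : Ideal R, HasProjectiveDimensionLT (ModuleCat.of R (R ⧸ I)) (n + 1)) :
    ringGlobalDim R ≤ n := by
  refine iSup_le fun X => ?_
  rw [projectiveDimension_le_iff]
  refine (hasProjectiveDimensionLT_iff X (n + 1)).2 fun i hi Y e => ?_
  have := hasInjectiveDimensionLT_of_cyclic n Y fun I e =>
    (h I).subsingleton _ _ _ le_rfl _ |>.elim _ _
  exact e.eq_zero_of_hasInjectiveDimensionLT _ hi

end RingGlobalDim

/-! ### Graded endomorphism rings -/

open DirectSum in
/-- The ring `Γ` is the graded endomorphism ring of `M`, the product of `α` and `β` being `α`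
followed by `β`. -/
structure GradedHom.EndRing {A : Type u} [Category.{v} A] [Preadditive A] (Y : GradedHom.{w} A)
    (M : A) (Γ : Type w) [Ring Γ] where
  equiv : (⨁ n, Y.E M M n) ≃+ Γ
  mul {m n : ℕ} (α : Y.E M M m) (β : Y.E M M n) :
    equiv (DirectSum.of _ m α) * equiv (DirectSum.of _ n β) =
      equiv (DirectSum.of _ (m + n) (Y.comp rfl α β))
  one : equiv (DirectSum.of _ 0 (Y.of (𝟙 M))) = 1

namespace GradedHom.EndRing

open DirectSum

variable {A : Type u} [Category.{v} A] [Preadditive A] {Y : GradedHom.{w} A} {M : A} {Γ : Type w}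
  [Ring Γ] (G : Y.EndRing M Γ)

/-- The opposite ring is the graded endomorphism ring in the opposite category. -/
def op : Y.op.EndRing (Opposite.op M) Γᵐᵒᵖ where
  equiv := G.equiv.trans MulOpposite.opAddEquiv
  mul {m n} α β := by
    refine (congrArg MulOpposite.op (G.mul β α)).trans ?_
    have : ∀ {p : ℕ} (h : n + m = p), DirectSum.of (fun n => Y.E M M n) (n + m) (Y.comp rfl β α) =
        DirectSum.of (fun n => Y.E M M n) p (Y.comp h β α) := by
      rintro _ rfl
      rfl
    rw [this (add_comm n m)]
    rfl
  one := congrArg MulOpposite.op G.one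

/-- The homogeneous elements of the graded endomorphism ring. -/
def el (n : ℕ) : Y.E M M n →+ Γ := G.equiv.toAddMonoidHom.comp (DirectSum.of _ n)

/-- The graded morphisms from `M` to `Z`, as a module over the graded endomorphism ring. -/
def Hom (_ : Y.EndRing M Γ) (Z : A) : Type w := ⨁ n, Y.E M Z n

instance (Z : A) : AddCommGroup (G.Hom Z) := inferInstanceAs (AddCommGroup (⨁ n, Y.E M Z n))

/-- The homogeneous elements of the module of graded morphisms. -/
def ι {Z : A} (n : ℕ) : Y.E M Z n →+ G.Hom Z := DirectSum.of _ n

/-- The component of degree zero. -/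
def c₀ {Z : A} : G.Hom Z →+ Y.E M Z 0 := DFinsupp.evalAddMonoidHom 0

@[simp] lemma c₀_ι_zero {Z : A} (x : Y.E M Z 0) : G.c₀ (G.ι 0 x) = x :=
  DirectSum.of_eq_same (β := Y.E M Z) 0 x

@[simp] lemma c₀_ι_succ {Z : A} {n : ℕ} (x : Y.E M Z (n + 1)) : G.c₀ (G.ι (n + 1) x) = 0 :=
  DirectSum.of_eq_of_ne (β := Y.E M Z) (n + 1) 0 x (Nat.succ_ne_zero n).symm

variable {G} in
lemma Hom.induction {Z : A} {p : G.Hom Z → Prop} (x : G.Hom Z) (zero : p 0)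
    (ι : ∀ n x, p (G.ι n x)) (add : ∀ x y, p x → p y → p (x + y)) : p x :=
  DirectSum.induction_on x zero ι add

lemma el_induction {p : Γ → Prop} (x : Γ) (zero : p 0) (el : ∀ n x, p (G.el n x))
    (add : ∀ x y, p x → p y → p (x + y)) : p x := by
  obtain ⟨x, rfl⟩ := G.equiv.surjective x
  refine DirectSum.induction_on x (by rwa [map_zero]) el fun x y hx hy => ?_
  rw [map_add]
  exact add _ _ hx hy

lemma el_mul {m n p : ℕ} (h : m + n = p) (α : Y.E M M m) (β : Y.E M M n) :
    G.el m α * G.el n β = G.el p (Y.comp h α β) := by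
  subst h
  exact G.mul α β

/-- The additive map with given homogeneous components. -/
def lift {Z : A} {B : Type w} [AddCommGroup B] (f : ∀ n, Y.E M Z n →+ B) : G.Hom Z →+ B :=
  DirectSum.toAddMonoid f

@[simp] lemma lift_ι {Z : A} {B : Type w} [AddCommGroup B] (f : ∀ n, Y.E M Z n →+ B) (n : ℕ)
    (x : Y.E M Z n) : G.lift f (G.ι n x) = f n x := DirectSum.toAddMonoid_of _ _ _

/-- The action of the graded endomorphism ring. -/
def act (Z : A) : Γ →+ G.Hom Z →+ G.Hom Z :=
  (DirectSum.toAddMonoid fun m => AddMonoidHom.mk'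
    (fun α => G.lift fun n => (G.ι (m + n)).comp (Y.comp rfl α)) fun α β => by
      refine AddMonoidHom.ext fun x => ?_
      induction x using Hom.induction with
      | zero => simp
      | ι n x => simp
      | add x y hx hy => rw [map_add, hx, hy, map_add]).comp G.equiv.symm.toAddMonoidHom

lemma act_el {Z : A} {m n p : ℕ} (h : m + n = p) (α : Y.E M M m) (x : Y.E M Z n) :
    G.act Z (G.el m α) (G.ι n x) = G.ι p (Y.comp h α x) := by
  subst h
  rw [act, el, AddMonoidHom.comp_apply, AddMonoidHom.comp_apply]
  erw [G.equiv.symm_apply_apply, DirectSum.toAddMonoid_of]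
  exact G.lift_ι _ n x

instance (Z : A) : Module Γ (G.Hom Z) where
  smul γ x := G.act Z γ x
  one_smul x := by
    change G.act Z 1 x = x
    rw [show (1 : Γ) = G.el 0 (Y.of (𝟙 M)) from G.one.symm]
    induction x using Hom.induction with
    | zero => rw [map_zero]
    | ι n x => rw [G.act_el (zero_add n), Y.id_comp]
    | add x y hx hy => rw [map_add, hx, hy]
  mul_smul γ δ x := by
    change G.act Z (γ * δ) x = G.act Z γ (G.act Z δ x)
    induction γ using G.el_induction with
    | zero => rw [zero_mul, map_zero]; rfl
    | add γ γ' h h' => rw [add_mul, map_add, map_add, AddMonoidHom.add_apply, h, h',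
        AddMonoidHom.add_apply]
    | el m α =>
      induction δ using G.el_induction with
      | zero => rw [mul_zero, map_zero, AddMonoidHom.zero_apply, map_zero]
      | add δ δ' h h' => rw [mul_add, map_add, map_add, AddMonoidHom.add_apply, h, h',
          AddMonoidHom.add_apply, map_add]
      | el n β =>
        induction x using Hom.induction with
        | zero => simp only [map_zero]
        | add x y hx hy => rw [map_add, hx, hy, map_add, map_add]
        | ι p x => rw [G.el_mul rfl, G.act_el rfl, G.act_el rfl, G.act_el (add_assoc m n p).symm,
            Y.assoc]
  smul_zero γ := map_zero (G.act Z γ)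
  smul_add γ := map_add (G.act Z γ)
  add_smul γ δ x := by
    change G.act Z (γ + δ) x = G.act Z γ x + G.act Z δ x
    rw [map_add]; rfl
  zero_smul x := by
    change G.act Z 0 x = 0
    rw [map_zero]; rfl

lemma el_smul_ι {Z : A} {m n p : ℕ} (h : m + n = p) (α : Y.E M M m) (x : Y.E M Z n) :
    G.el m α • G.ι n x = G.ι p (Y.comp h α x) := G.act_el h α x

/-- An additive map which is compatible with homogeneous elements is linear. -/
def linearMapOf {Z : A} {B : Type w} [AddCommGroup B] [Module Γ B] (f : G.Hom Z →+ B)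
    (hf : ∀ m n (α : Y.E M M m) (x : Y.E M Z n), f (G.el m α • G.ι n x) = G.el m α • f (G.ι n x)) :
    G.Hom Z →ₗ[Γ] B where
  __ := f
  map_smul' γ x := by
    change f (γ • x) = γ • f x
    induction γ using G.el_induction with
    | zero => simp
    | add γ γ' h h' => rw [add_smul, map_add, h, h', add_smul]
    | el m α =>
      induction x using Hom.induction with
      | zero => simp
      | add x y hx hy => rw [smul_add, map_add, hx, hy, map_add, smul_add]
      | ι n x => exact hf m n α x

/-- Composition with a graded morphism. -/
def push {Z W : A} {m : ℕ} (θ : Y.E Z W m) : G.Hom Z →ₗ[Γ] G.Hom W :=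
  G.linearMapOf (G.lift fun n => (G.ι (n + m)).comp ((Y.comp rfl).flip θ)) fun i j α x => by
    -- Associativity moves between the degrees `(i + j) + m` and `i + (j + m)`; this transports
    -- homogeneous elements along the equality.
    have : ∀ {a b : ℕ} (h : a = b) {c d : ℕ} (hc : c + d = a) (x : Y.E M Z c) (y : Y.E Z W d),
      G.ι a (Y.comp hc x y) = G.ι b (Y.comp (hc.trans h) x y) := by
        rintro _ _ rfl _ _ _ _ _
        rfl
    simp only [G.el_smul_ι rfl, lift_ι, AddMonoidHom.comp_apply, AddMonoidHom.flip_apply]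
    rw [this (add_assoc i j m), Y.assoc _ rfl _ rfl]

lemma push_ι {Z W : A} {m n p : ℕ} (h : n + m = p) (θ : Y.E Z W m) (x : Y.E M Z n) :
    G.push θ (G.ι n x) = G.ι p (Y.comp h x θ) := by
  subst h
  exact G.lift_ι (fun n => (G.ι (n + m)).comp ((Y.comp rfl).flip θ)) n x

/-- The graded endomorphism ring as a module of graded morphisms. -/
def selfEquiv : G.Hom M ≃ₗ[Γ] Γ :=
  { G.linearMapOf G.equiv.toAddMonoidHom fun m n α x => by
      rw [G.el_smul_ι rfl]
      exact (G.mul α x).symm with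
    invFun := G.equiv.symm
    left_inv := G.equiv.symm_apply_apply
    right_inv := G.equiv.apply_symm_apply }

lemma selfEquiv_ι {n : ℕ} (x : Y.E M M n) : G.selfEquiv (G.ι n x) = G.el n x := rfl

/-- The elements of degree zero given by morphisms. -/
def ofHom {Z : A} (f : M ⟶ Z) : G.Hom Z := G.ι 0 (Y.of f)

/-- A dual basis of `G.Hom Z`: the elements `v r` in degree zero generate, with coordinates given by
composition with `u r`. Projectivity and the determination of linear maps by degree zero elements
both rest on it. -/
lemma eq_sum_smul {Z : A} {n : ℕ} {u : Fin n → (Z ⟶ M)} {v : Fin n → (M ⟶ Z)}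
    (h : ∑ r, u r ≫ v r = 𝟙 Z) (x : G.Hom Z) :
    ∑ r, G.selfEquiv (G.push (Y.of (u r)) x) • G.ofHom (v r) = x := by
  induction x using Hom.induction with
  | zero => simp
  | add x y hx hy =>
    conv_rhs => rw [← hx, ← hy]
    simp only [map_add, add_smul, Finset.sum_add_distrib]
  | ι m x =>
    have (r : Fin n) : G.selfEquiv (G.push (Y.of (u r)) (G.ι m x)) • G.ofHom (v r) =
        G.ι m (Y.comp (add_zero m) x (Y.of (u r ≫ v r))) := by
      rw [G.push_ι (add_zero m), selfEquiv_ι, ofHom, G.el_smul_ι (add_zero m),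
        Y.assoc _ (zero_add 0) _ (add_zero m), Y.of_comp]
    simp only [this]
    rw [← map_sum, ← map_sum, ← map_sum, h, Y.comp_id]

end GradedHom.EndRing

/-! ### Graded morphisms from `M`, and their quotients by positive degrees -/

namespace GradedHom.EndRing

section

variable {A : Type u} [Category.{v} A] [Preadditive A] {Y : GradedHom.{w} A} {M : A} {Γ : Type w}
  [Ring Γ] (G : Y.EndRing M Γ)

lemma push_push {Z W V : A} {m n p : ℕ} (h : m + n = p) (θ : Y.E Z W m) (τ : Y.E W V n)
    (x : G.Hom Z) : G.push τ (G.push θ x) = G.push (Y.comp h θ τ) x := by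
  induction x using Hom.induction with
  | zero => simp
  | add x y hx hy => simp only [map_add, hx, hy]
  | ι i x =>
    rw [G.push_ι rfl, G.push_ι rfl, G.push_ι (show i + p = i + m + n by rw [← h, add_assoc]),
      Y.assoc _ h]

lemma push_of_push_of {Z W V : A} (f : Z ⟶ W) (g : W ⟶ V) (x : G.Hom Z) :
    G.push (Y.of g) (G.push (Y.of f) x) = G.push (Y.of (f ≫ g)) x := by
  rw [G.push_push (zero_add 0), Y.of_comp]

lemma push_of_id {Z : A} (x : G.Hom Z) : G.push (Y.of (𝟙 Z)) x = x := by
  induction x using Hom.induction with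
  | zero => simp
  | add x y hx hy => rw [map_add, hx, hy]
  | ι i x => rw [G.push_ι (add_zero i), Y.comp_id]

lemma push_zero {Z W : A} {m : ℕ} (x : G.Hom Z) : G.push (0 : Y.E Z W m) x = 0 := by
  induction x using Hom.induction with
  | zero => simp
  | add x y hx hy => rw [map_add, hx, hy, add_zero]
  | ι i x => rw [G.push_ι rfl, map_zero, map_zero]

lemma push_ofHom {Z W : A} (f : M ⟶ Z) (g : Z ⟶ W) :
    G.push (Y.of g) (G.ofHom f) = G.ofHom (f ≫ g) := by
  rw [ofHom, G.push_ι (add_zero 0), ofHom, Y.of_comp]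

lemma hom_ext (hM : IsAddGenerating fun _ : PUnit.{1} => M) {Z : A} {B : Type w} [AddCommGroup B]
    [Module Γ B] {f g : G.Hom Z →ₗ[Γ] B} (h : ∀ v, f (G.ofHom v) = g (G.ofHom v)) : f = g := by
  obtain ⟨n, _, u, v, huv⟩ := hM Z
  ext x
  rw [← G.eq_sum_smul huv x]
  simp only [map_sum, map_smul, h]

lemma projective (hM : IsAddGenerating fun _ : PUnit.{1} => M) (Z : A) :
    Projective (ModuleCat.of Γ (G.Hom Z)) where
  factors {E X} f e _ := by
    obtain ⟨n, _, u, v, huv⟩ := hM Z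
    have he := (ModuleCat.epi_iff_surjective e).1 inferInstance
    choose y hy using fun r => he (f (G.ofHom (v r)))
    refine ⟨ModuleCat.ofHom (∑ r, (LinearMap.toSpanSingleton Γ E (y r)).comp
      (G.selfEquiv.toLinearMap.comp (G.push (Y.of (u r))))), ?_⟩
    ext x
    refine Eq.trans ?_ (congrArg f (G.eq_sum_smul huv x))
    change e.hom ((∑ r, (LinearMap.toSpanSingleton Γ E (y r)).comp
      (G.selfEquiv.toLinearMap.comp (G.push (Y.of (u r))))) x) = f.hom _
    rw [LinearMap.sum_apply, map_sum, map_sum]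
    refine Finset.sum_congr rfl fun r _ => ?_
    rw [map_smul]
    refine (map_smul e.hom _ _).trans ?_
    congr 1
    exact hy r

lemma c₀_el_zero_smul {Z : A} (α : Y.E M M 0) (x : G.Hom Z) :
    G.c₀ (G.el 0 α • x) = Y.comp (zero_add 0) α (G.c₀ x) := by
  induction x using Hom.induction with
  | zero => simp
  | add x y hx hy => rw [smul_add, map_add, hx, hy, map_add, map_add]
  | ι n x =>
    rw [G.el_smul_ι (zero_add n)]
    cases n with
    | zero => simp
    | succ n => simp

lemma c₀_el_succ_smul {Z : A} {n : ℕ} (α : Y.E M M (n + 1)) (x : G.Hom Z) :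
    G.c₀ (G.el (n + 1) α • x) = 0 := by
  induction x using Hom.induction with
  | zero => simp
  | add x y hx hy => rw [smul_add, map_add, hx, hy, zero_add]
  | ι m x => rw [G.el_smul_ι (show n + 1 + m = n + m + 1 by lia), c₀_ι_succ]

lemma c₀_push {Z W : A} (f : Z ⟶ W) (x : G.Hom Z) :
    G.c₀ (G.push (Y.of f) x) = Y.comp (add_zero 0) (G.c₀ x) (Y.of f) := by
  induction x using Hom.induction with
  | zero => simp
  | add x y hx hy => rw [map_add, map_add, hx, hy, map_add, map_add, AddMonoidHom.add_apply]
  | ι n x =>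
    rw [G.push_ι (add_zero n)]
    cases n with
    | zero => simp
    | succ n => simp

lemma c₀_push_succ {Z W : A} {n : ℕ} (θ : Y.E Z W (n + 1)) (x : G.Hom Z) :
    G.c₀ (G.push θ x) = 0 := by
  induction x using Hom.induction with
  | zero => simp
  | add x y hx hy => rw [map_add, map_add, hx, hy, zero_add]
  | ι m x => rw [G.push_ι (show m + (n + 1) = m + n + 1 by lia), c₀_ι_succ]

/-- The homogeneous components. -/
def component {Z : A} (n : ℕ) : G.Hom Z →+ Y.E M Z n := DFinsupp.evalAddMonoidHom n

lemma component_ι {Z : A} {n : ℕ} (x : Y.E M Z n) : G.component n (G.ι n x) = x :=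
  DirectSum.of_eq_same (β := Y.E M Z) n x

lemma component_ι_ne {Z : A} {m n : ℕ} (h : m ≠ n) (x : Y.E M Z m) :
    G.component n (G.ι m x) = 0 :=
  DirectSum.of_eq_of_ne (β := Y.E M Z) m n x h.symm

lemma eq_zero_of_component {Z : A} (x : G.Hom Z) (h : ∀ n, G.component n x = 0) : x = 0 :=
  DFinsupp.ext h

lemma component_push {Z W : A} {m n : ℕ} (θ : Y.E Z W m) (x : G.Hom Z) :
    G.component (n + m) (G.push θ x) = Y.comp rfl (G.component n x) θ := by
  induction x using Hom.induction with
  | zero => simp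
  | add x y hx hy => rw [map_add, map_add, hx, hy, map_add, map_add, AddMonoidHom.add_apply]
  | ι i x =>
    rw [G.push_ι rfl]
    by_cases h : i = n
    · subst h
      rw [component_ι, component_ι]
    · rw [component_ι_ne _ (by lia), component_ι_ne _ h, map_zero, AddMonoidHom.zero_apply]

/-- The submodule of elements of positive degree. -/
def pos (Z : A) : Submodule Γ (G.Hom Z) where
  carrier := {x | G.c₀ x = 0}
  zero_mem' := map_zero _
  add_mem' {x y} hx hy := by
    change G.c₀ (x + y) = 0
    rw [map_add, show G.c₀ x = 0 from hx, show G.c₀ y = 0 from hy, add_zero]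
  smul_mem' γ x hx := by
    change G.c₀ (γ • x) = 0
    induction γ using G.el_induction with
    | zero => rw [zero_smul, map_zero]
    | add γ δ h h' => rw [add_smul, map_add, h, h', add_zero]
    | el m α =>
      cases m with
      | zero => rw [c₀_el_zero_smul, show G.c₀ x = 0 from hx, map_zero]
      | succ m => exact G.c₀_el_succ_smul α x

lemma mem_pos {Z : A} {x : G.Hom Z} : x ∈ G.pos Z ↔ G.c₀ x = 0 := Iff.rfl

/-- The quotient by the elements of positive degree. -/
abbrev Top (Z : A) : Type w := G.Hom Z ⧸ G.pos Z

/-- The class of a morphism. -/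
def cls {Z : A} (f : M ⟶ Z) : G.Top Z := (G.pos Z).mkQ (G.ofHom f)

lemma mkQ_eq_cls {Z : A} (x : G.Hom Z) : (G.pos Z).mkQ x = G.cls (Y.of.symm (G.c₀ x)) := by
  rw [cls, ← sub_eq_zero, ← map_sub]
  refine (Submodule.Quotient.mk_eq_zero _).2 ?_
  rw [mem_pos, map_sub, ofHom, c₀_ι_zero, AddEquiv.apply_symm_apply, sub_self]

lemma cls_surjective {Z : A} (x : G.Top Z) : ∃ f, G.cls f = x := by
  obtain ⟨x, rfl⟩ := (G.pos Z).mkQ_surjective x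
  exact ⟨_, (G.mkQ_eq_cls x).symm⟩

lemma cls_eq_zero {Z : A} {f : M ⟶ Z} : G.cls f = 0 ↔ f = 0 := by
  refine (Submodule.Quotient.mk_eq_zero _).trans ?_
  rw [mem_pos, ofHom, c₀_ι_zero, map_eq_zero_iff _ Y.of.injective]

lemma cls_add {Z : A} (f g : M ⟶ Z) : G.cls (f + g) = G.cls f + G.cls g := by
  rw [cls, ofHom, map_add, map_add, map_add]
  rfl

lemma cls_comp {Z : A} (e : M ⟶ M) (f : M ⟶ Z) :
    G.cls (e ≫ f) = G.el 0 (Y.of e) • G.cls f := by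
  rw [cls, cls, ← map_smul, ofHom, ofHom, G.el_smul_ι (zero_add 0), Y.of_comp]

/-- The functoriality of the quotient by the elements of positive degree. -/
def topMap {Z W : A} (f : Z ⟶ W) : G.Top Z →ₗ[Γ] G.Top W :=
  Submodule.mapQ _ _ (G.push (Y.of f)) fun x hx => by
    rw [Submodule.mem_comap, mem_pos, c₀_push, show G.c₀ x = 0 from hx, map_zero,
      AddMonoidHom.zero_apply]

lemma topMap_cls {Z W : A} (f : Z ⟶ W) (g : M ⟶ Z) : G.topMap f (G.cls g) = G.cls (g ≫ f) :=
  congrArg (G.pos W).mkQ (G.push_ofHom g f)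

/-- A linear map need not be homogeneous, but it is determined by its values on the degree zero
generators `v r`, and modulo positive degrees only the degree zero components of these values
matter. They are assembled to `f₀` by means of `u r`. -/
lemma exists_degree_zero (hM : IsAddGenerating fun _ : PUnit.{1} => M) {Z W : A}
    (f : G.Hom Z →ₗ[Γ] G.Hom W) : ∃ f₀ : Z ⟶ W, ∀ x, (G.pos W).mkQ (f x) =
      G.topMap f₀ ((G.pos Z).mkQ x) := by
  obtain ⟨n, _, u, v, huv⟩ := hM Z
  let φ (h : M ⟶ Z) : M ⟶ W := Y.of.symm (G.c₀ (f (G.ofHom h)))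
  refine ⟨∑ r, u r ≫ φ (v r), fun x => ?_⟩
  suffices h : (G.pos W).mkQ.comp f = (G.topMap (∑ r, u r ≫ φ (v r))).comp (G.pos Z).mkQ from
    LinearMap.congr_fun h x
  refine G.hom_ext hM fun h => ?_
  rw [LinearMap.comp_apply, LinearMap.comp_apply, mkQ_eq_cls]
  refine Eq.trans ?_ (G.topMap_cls _ _).symm
  refine congrArg G.cls ?_
  conv_lhs => rw [← Category.comp_id h, ← huv, Preadditive.comp_sum, ofHom, map_sum, map_sum,
    map_sum, map_sum, map_sum]
  rw [Preadditive.comp_sum]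
  refine Finset.sum_congr rfl fun r _ => ?_
  rw [← Category.assoc, ← Y.of_comp, ← G.el_smul_ι (zero_add 0), map_smul, c₀_el_zero_smul]
  refine Y.of.injective ?_
  rw [AddEquiv.apply_symm_apply, ← Category.assoc, ← Y.of_comp _ (φ (v r)),
    AddEquiv.apply_symm_apply]
  rfl

/-- The elements of degree zero in `Γ` act on the top through `End M`, so submodules of the top
embed into submodules of `M ⟶ Z`. -/
lemma isNoetherian_top {Z : A} (h : IsNoetherian (End M)ᵐᵒᵖ (M ⟶ Z)) :
    IsNoetherian Γ (G.Top Z) := by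
  rw [isNoetherian_iff']
  let F (N : Submodule Γ (G.Top Z)) : Submodule (End M)ᵐᵒᵖ (M ⟶ Z) :=
    { carrier := {f | G.cls f ∈ N}
      zero_mem' := by
        change G.cls 0 ∈ N
        rw [G.cls_eq_zero.2 rfl]
        exact N.zero_mem
      add_mem' {f g} hf hg := by
        change G.cls (f + g) ∈ N
        rw [cls_add]
        exact N.add_mem hf hg
      smul_mem' e f hf := by
        change G.cls (e.unop ≫ f) ∈ N
        rw [cls_comp]
        exact N.smul_mem _ hf }
  have hF (N N') : F N ≤ F N' ↔ N ≤ N' := by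
    refine ⟨fun h x hx => ?_, fun h f hf => h hf⟩
    obtain ⟨f, rfl⟩ := G.cls_surjective x
    exact h hx
  exact (OrderEmbedding.ofMapLEIff F hF).strictMono.wellFoundedGT

end

/-! ### Resolutions, noetherianity and global dimension of the graded endomorphism ring -/

variable {A : Type u} [Category.{v} A] [Abelian A] {Y : GradedHom.{w} A} {M : A} {Γ : Type w}
  [Ring Γ] (G : Y.EndRing M Γ) {R : ℕ → A → Prop} (hY : Y.IsResolving R)

include hY in
lemma eq_zero_of_c₀ {Z : A} (hZ : R 0 Z) {x : G.Hom Z} (hx : G.c₀ x = 0) : x = 0 := by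
  have : x = G.ι 0 (G.c₀ x) := by
    clear hx
    induction x using Hom.induction with
    | zero => simp
    | add x y hx hy => rw [map_add, map_add, ← hx, ← hy]
    | ι n x =>
      cases n with
      | zero => simp
      | succ n => rw [hY.eq_zero hZ _ x, map_zero, map_zero, map_zero]
  rw [this, hx, map_zero]

include hY in
/-- The resolution of a module of graded morphisms. -/
lemma exists_resolution {n : ℕ} {Z : A} (h : R (n + 1) Z) : ∃ (S : ShortComplex A)
    (_ : S.ShortExact) (η : Y.E S.X₃ Z 1), R 0 S.X₂ ∧ R n S.X₁ ∧ R n S.X₃ ∧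
    (∀ x, G.push η (G.push (Y.of S.g) x) = 0) ∧
    (∀ x, G.push η x = 0 → ∃ y, G.push (Y.of S.g) y = x) ∧
    ∀ x, G.c₀ x = 0 → ∃ y, G.push η y = x := by
  obtain ⟨S, hS, η, h₂, h₁, h₃, hη, ha₁, ha₂, ha₃⟩ := hY.exists_resolution h
  refine ⟨S, hS, η, h₂, h₁, h₃, fun x => ?_, fun x hx => ?_, fun x hx => ?_⟩
  · rw [G.push_push (zero_add 1), hη, push_zero]
  -- The element `x` need not be homogeneous. Its components of positive degree vanish, since `η` is
  -- injective there, and its degree zero component lifts through `S.g`.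
  · have hx' (n : ℕ) : Y.comp rfl (G.component n x) η = 0 := by
      rw [← component_push, hx, map_zero]
    obtain ⟨y, hy⟩ := ha₃ M (Y.of.symm (G.c₀ x)) (by
      rw [AddEquiv.apply_symm_apply]
      exact hx' 0)
    refine ⟨G.ofHom y, ?_⟩
    rw [push_ofHom, hy, ofHom, AddEquiv.apply_symm_apply]
    refine sub_eq_zero.1 (G.eq_zero_of_component _ fun n => ?_)
    rw [map_sub]
    cases n with
    | zero => exact sub_eq_zero.2 (G.c₀_ι_zero _)
    | succ n =>
      rw [component_ι_ne _ (Nat.succ_ne_zero n).symm, ha₂ _ _ _ (hx' (n + 1)), sub_zero]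
  · have (x : G.Hom Z) : ∃ y, G.push η y = x - G.ι 0 (G.c₀ x) := by
      clear hx
      induction x using Hom.induction with
      | zero => exact ⟨0, by simp⟩
      | add x x' hx hx' =>
        obtain ⟨y, hy⟩ := hx
        obtain ⟨y', hy'⟩ := hx'
        exact ⟨y + y', by rw [map_add, hy, hy', map_add, map_add]; abel⟩
      | ι n x =>
        cases n with
        | zero => exact ⟨0, by simp⟩
        | succ n =>
          obtain ⟨y, rfl⟩ := ha₁ _ _ x
          exact ⟨G.ι n y, by rw [G.push_ι rfl, c₀_ι_succ, map_zero, sub_zero]⟩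
    obtain ⟨y, hy⟩ := this x
    exact ⟨y, by rw [hy, hx, map_zero, sub_zero]⟩

lemma exactPair_topMap_kernel {Z W : A} (f : Z ⟶ W) :
    Function.Injective (G.topMap (kernel.ι f)) ∧ (∀ x, G.topMap f (G.topMap (kernel.ι f) x) = 0) ∧
    ∀ x, G.topMap f x = 0 → ∃ y, G.topMap (kernel.ι f) y = x := by
  refine ⟨(injective_iff_map_eq_zero _).2 fun x hx => ?_, fun x => ?_, fun x hx => ?_⟩
  · obtain ⟨x, rfl⟩ := G.cls_surjective x
    rw [topMap_cls, cls_eq_zero] at hx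
    rw [zero_of_comp_mono _ hx, cls_eq_zero]
  · obtain ⟨x, rfl⟩ := G.cls_surjective x
    rw [topMap_cls, topMap_cls, Category.assoc, kernel.condition, comp_zero, cls_eq_zero]
  · obtain ⟨x, rfl⟩ := G.cls_surjective x
    rw [topMap_cls, cls_eq_zero] at hx
    exact ⟨G.cls (kernel.lift f x hx), by rw [topMap_cls, kernel.lift_ι]⟩

-- By induction on the rank: `G.Hom Z` is an extension of its noetherian top by a quotient of `G.Hom
-- S.X₃`, where `S.X₃` has smaller rank.
include hY in
lemma isNoetherian (hM : ∀ Z, IsNoetherian (End M)ᵐᵒᵖ (M ⟶ Z)) {n : ℕ} {Z : A} (h : R n Z) :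
    IsNoetherian Γ (G.Hom Z) := by
  induction n generalizing Z with
  | zero =>
    have := G.isNoetherian_top (hM Z)
    refine isNoetherian_of_injective (G.pos Z).mkQ ((injective_iff_map_eq_zero _).2 fun x hx => ?_)
    exact G.eq_zero_of_c₀ hY h (G.mem_pos.1 ((Submodule.Quotient.mk_eq_zero _).1 hx))
  | succ n ih =>
    obtain ⟨S, hS, η, -, -, h₃, -, -, hη⟩ := G.exists_resolution hY h
    have := G.isNoetherian_top (hM Z)
    have := ih h₃
    refine isNoetherian_of_range_eq_ker (G.push η) (G.pos Z).mkQ (le_antisymm ?_ ?_)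
    · rintro _ ⟨x, rfl⟩
      exact (Submodule.Quotient.mk_eq_zero _).2 (G.c₀_push_succ η x)
    · intro x hx
      exact hη x (G.mem_pos.1 ((Submodule.Quotient.mk_eq_zero _).1 hx))

include hY in
/-- The stratification of the modules over a graded endomorphism ring. -/
noncomputable def stratification (hM : IsAddGenerating fun _ : PUnit.{1} => M) :
    Stratification (ModuleCat.{w} Γ) A where
  P Z := ModuleCat.of Γ (G.Hom Z)
  S Z := ModuleCat.of Γ (G.Top Z)
  π Z := ModuleCat.ofHom (G.pos Z).mkQ
  epi_π Z := (ModuleCat.epi_iff_surjective _).2 (G.pos Z).mkQ_surjective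
  proj Z := G.projective hM Z
  R := R
  exists_sum Z W := by
    let m {Z W : A} (f : Z ⟶ W) : ModuleCat.of Γ (G.Hom Z) ⟶ ModuleCat.of Γ (G.Hom W) :=
      ModuleCat.ofHom (G.push (Y.of f))
    have hm {Z W V : A} (f : Z ⟶ W) (g : W ⟶ V) : m f ≫ m g = m (f ≫ g) := by
      ext x
      exact G.push_of_push_of f g x
    have hm₀ (Z W : A) : m (0 : Z ⟶ W) = 0 := by
      ext x
      change G.push (Y.of 0) x = 0
      rw [map_zero, push_zero]
    have hm₁ (Z : A) : m (𝟙 Z) = 𝟙 _ := by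
      ext x
      exact G.push_of_id x
    refine ⟨Z ⊞ W, biprod.lift (m biprod.fst) (m biprod.snd), ?_⟩
    have : biprod.desc (m biprod.inl) (m biprod.inr) ≫
        biprod.lift (m (biprod.fst : Z ⊞ W ⟶ Z)) (m biprod.snd) = 𝟙 _ := by
      apply biprod.hom_ext' <;> apply biprod.hom_ext <;> simp [hm, hm₀, hm₁]
    have : Epi (biprod.desc (m biprod.inl) (m biprod.inr) ≫
        biprod.lift (m (biprod.fst : Z ⊞ W ⟶ Z)) (m biprod.snd)) := by
      rw [this]; infer_instance
    exact epi_of_epi (biprod.desc (m biprod.inl) (m biprod.inr)) _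
  exists_kernel {Z W} f := by
    obtain ⟨f₀, hf₀⟩ := G.exists_degree_zero hM f.hom
    obtain ⟨h₁, h₂, h₃⟩ := G.exactPair_topMap_kernel f₀
    refine ⟨kernel f₀, ModuleCat.ofHom (G.push (Y.of (kernel.ι f₀))),
      ModuleCat.ofHom (G.topMap (kernel.ι f₀)), ModuleCat.ofHom (G.topMap f₀), rfl, ?_,
      (ModuleCat.mono_iff_injective _).2 h₁, ModuleCat.exactPair_of_exact h₂ h₃⟩
    ext x
    exact hf₀ x
  mono_π {Z} h := (ModuleCat.mono_iff_injective _).2 <|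
    (injective_iff_map_eq_zero (G.pos Z).mkQ).2 fun x hx =>
      G.eq_zero_of_c₀ hY h (G.mem_pos.1 ((Submodule.Quotient.mk_eq_zero _).1 hx))
  exists_resolution {n Z} h := by
    obtain ⟨S, hS, η, h₂, h₁, h₃, hη₁, hη₂, hη₃⟩ := G.exists_resolution hY h
    have hinj : Function.Injective (G.pos S.X₂).mkQ :=
      (injective_iff_map_eq_zero (G.pos S.X₂).mkQ).2 fun x hx =>
        G.eq_zero_of_c₀ hY h₂ (G.mem_pos.1 ((Submodule.Quotient.mk_eq_zero _).1 hx))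
    let e : G.Hom S.X₂ ≃ₗ[Γ] G.Top S.X₂ :=
      LinearEquiv.ofBijective _ ⟨hinj, (G.pos S.X₂).mkQ_surjective⟩
    have he (f : M ⟶ S.X₂) : e.symm (G.cls f) = G.ofHom f := e.symm_apply_apply (G.ofHom f)
    have := hS.mono_f
    refine ⟨S.X₁, S.X₂, S.X₃, ModuleCat.ofHom (e.symm.toLinearMap.comp (G.topMap S.f)),
      ModuleCat.ofHom (G.push (Y.of S.g)), ModuleCat.ofHom (G.push η), h₁, h₃,
      (ModuleCat.mono_iff_injective _).2 (e.symm.injective.comp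
        ((injective_iff_map_eq_zero _).2 fun x hx => ?_)),
      ModuleCat.exactPair_of_exact (fun x => ?_) fun x hx => ?_,
      ModuleCat.exactPair_of_exact hη₁ hη₂,
      ModuleCat.exactPair_of_exact (fun x => ?_) fun x hx => hη₃ x (G.mem_pos.1
        ((Submodule.Quotient.mk_eq_zero _).1 hx))⟩
    · obtain ⟨x, rfl⟩ := G.cls_surjective x
      rw [topMap_cls, cls_eq_zero] at hx
      rw [zero_of_comp_mono _ hx, cls_eq_zero]
    · obtain ⟨x, rfl⟩ := G.cls_surjective x
      change G.push (Y.of S.g) (e.symm (G.topMap S.f (G.cls x))) = 0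
      rw [topMap_cls, he, push_ofHom, Category.assoc, S.zero, comp_zero, ofHom, map_zero, map_zero]
    · obtain ⟨x, rfl⟩ := e.symm.surjective x
      obtain ⟨x, rfl⟩ := G.cls_surjective x
      change G.push (Y.of S.g) (e.symm _) = 0 at hx
      rw [he, push_ofHom] at hx
      have hx' : x ≫ S.g = 0 := by
        rw [← G.cls_eq_zero, cls, hx, map_zero]
      refine ⟨G.cls (hS.exact.lift x hx'), ?_⟩
      change e.symm (G.topMap S.f _) = _
      rw [topMap_cls, hS.exact.lift_f]
    · exact (Submodule.Quotient.mk_eq_zero _).2 (G.c₀_push_succ η x)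

-- Noetherianity makes every left ideal `I` a quotient of some `G.Hom (M^n)`, so `Γ ⧸ I` has a
-- presentation to which the bound for the stratification applies; cyclic modules suffice.
include G hY in
lemma ringGlobalDim_le (hM : IsAddGenerating fun _ : PUnit.{1} => M)
    (hfin : ∀ Z, IsNoetherian (End M)ᵐᵒᵖ (M ⟶ Z)) {N : ℕ} (hN : ∀ Z, R N Z) :
    ringGlobalDim Γ ≤ ((3 * N + 2 : ℕ) : WithBot ℕ∞) := by
  have := Abelian.hasFiniteBiproducts (C := A)
  have := G.isNoetherian hY hfin (hN M)
  have : IsNoetherianRing Γ := isNoetherian_of_linearEquiv G.selfEquiv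
  refine ringGlobalDim_le_of_cyclic _ fun I => ?_
  obtain ⟨n, f, hf⟩ := Module.Finite.exists_fin' Γ I
  let F : G.Hom (⨁ fun _ : Fin n => M) →ₗ[Γ] I :=
    f.comp (LinearMap.pi fun r => G.selfEquiv.toLinearMap.comp (G.push (Y.of (biproduct.π _ r))))
  have hF : Function.Surjective F := fun y => by
    obtain ⟨x, rfl⟩ := hf y
    refine ⟨∑ r, G.push (Y.of (biproduct.ι (fun _ => M) r)) (G.selfEquiv.symm (x r)), ?_⟩
    refine congrArg f (funext fun r => ?_)
    change G.selfEquiv (G.push (Y.of (biproduct.π (fun _ => M) r)) _) = _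
    rw [map_sum, Finset.sum_eq_single r, push_of_push_of, biproduct.ι_π_self, push_of_id,
      LinearEquiv.apply_symm_apply]
    · intro r' _ hr
      rw [push_of_push_of, biproduct.ι_π_ne _ hr, map_zero, push_zero]
    · simp
  have : Epi (X := (G.stratification hY hM).P (⨁ fun _ : Fin n => M)) (ModuleCat.ofHom F) :=
    (ModuleCat.epi_iff_surjective _).2 hF
  have : Epi (ModuleCat.ofHom I.mkQ) := (ModuleCat.epi_iff_surjective _).2 I.mkQ_surjective
  exact (G.stratification hY hM).dim_of_presentation hN (a := M) (b := ⨁ fun _ : Fin n => M)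
    (Retract.ofIso G.selfEquiv.symm.toModuleIso) (ModuleCat.ofHom F)
    (ModuleCat.ofHom I.subtype) (ModuleCat.ofHom I.mkQ)
    (ModuleCat.exactPair_of_exact (fun x => (Submodule.Quotient.mk_eq_zero I).2 x.2)
      fun x hx => ⟨⟨x, (Submodule.Quotient.mk_eq_zero I).1 hx⟩, rfl⟩)

end GradedHom.EndRing

/-! ### Finitely generated modules over a finite-dimensional algebra -/

section FinMod

open scoped ModuleCat

variable {k : Type t} {Λ : Type u} [Field k] [Ring Λ] [Algebra k Λ]

/-! ### Coinduced modules -/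

section Coinduced

variable (k Λ) in
/-- The `Λ`-module of `k`-linear maps from `Λ` to a `k`-module. -/
def Coinduced (V : Type u) [AddCommGroup V] [Module k V] : Type u := Λ →ₗ[k] V

variable {V : Type u} [AddCommGroup V] [Module k V]

noncomputable instance : AddCommGroup (Coinduced k Λ V) :=
  inferInstanceAs (AddCommGroup (Λ →ₗ[k] V))

noncomputable instance : Module k (Coinduced k Λ V) := inferInstanceAs (Module k (Λ →ₗ[k] V))

noncomputable instance : FunLike (Coinduced k Λ V) Λ V := inferInstanceAs (FunLike (Λ →ₗ[k] V) Λ V)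

noncomputable instance : Module Λ (Coinduced k Λ V) where
  smul a f := LinearMap.comp (f : Λ →ₗ[k] V) (LinearMap.mulRight k a)
  one_smul f := LinearMap.ext fun x => congrArg f (mul_one x)
  mul_smul a b f := LinearMap.ext fun x => congrArg f (mul_assoc x a b).symm
  smul_zero _ := rfl
  smul_add _ _ _ := rfl
  add_smul a b f := LinearMap.ext fun x =>
    (congrArg f (mul_add x a b)).trans (LinearMap.map_add (show Λ →ₗ[k] V from f) _ _)
  zero_smul f := LinearMap.ext fun x =>
    (congrArg f (mul_zero x)).trans (LinearMap.map_zero (show Λ →ₗ[k] V from f))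

instance : IsScalarTower k Λ (Coinduced k Λ V) where
  smul_assoc c a f := LinearMap.ext fun x =>
    (congrArg f (mul_smul_comm c x a)).trans (LinearMap.map_smul (show Λ →ₗ[k] V from f) _ _)

variable [FiniteDimensional k Λ]

instance [FiniteDimensional k V] : Module.Finite Λ (Coinduced k Λ V) := by
  have : FiniteDimensional k (Coinduced k Λ V) :=
    inferInstanceAs (FiniteDimensional k (Λ →ₗ[k] V))
  exact Module.Finite.of_restrictScalars_finite k Λ _

end Coinduced

variable [FiniteDimensional k Λ]

instance (M : FinMod k Λ) : FiniteDimensional k M.obj :=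
  have : Module.Finite Λ M.obj := M.property
  Module.Finite.trans Λ _

lemma finMod_injective {M N : FinMod k Λ} (f : M ⟶ N) [Mono f] : Function.Injective f.hom := by
  have : (isFinMod k Λ).ι.PreservesMonomorphisms :=
    (isFinMod k Λ).preservesMonomorphisms_ι_of_isNormalEpiCategory
  exact (ModuleCat.mono_iff_injective f.hom).1 (inferInstanceAs (Mono ((isFinMod k Λ).ι.map f)))

lemma finMod_surjective {M N : FinMod k Λ} (f : M ⟶ N) [Epi f] : Function.Surjective f.hom := by
  have : (isFinMod k Λ).ι.PreservesEpimorphisms :=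
    (isFinMod k Λ).preservesEpimorphisms_ι_of_isNormalMonoCategory
  exact (ModuleCat.epi_iff_surjective f.hom).1 (inferInstanceAs (Epi ((isFinMod k Λ).ι.map f)))

/-- Embed `M` into `Hom_k(Λ, M)` by `m ↦ (x ↦ x m)`. The target is injective since `Λ`-linear maps
into it correspond to `k`-linear maps into `M`, by evaluation at `1`, and these extend along
`k`-split monomorphisms. -/
instance finMod_enoughInjectives : EnoughInjectives (FinMod k Λ) where
  presentation M := by
    let J : FinMod k Λ := ⟨ModuleCat.of Λ (Coinduced k Λ M.obj),
      (inferInstance : Module.Finite Λ (Coinduced k Λ M.obj))⟩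
    let ι : M.obj →ₗ[Λ] Coinduced k Λ M.obj :=
      { toFun m := (LinearMap.toSpanSingleton Λ M.obj m).restrictScalars k
        map_add' m m' := LinearMap.ext fun x => smul_add x m m'
        map_smul' a m := LinearMap.ext fun x => (mul_smul x a m).symm }
    have hι : Function.Injective ι := fun m m' h => by
      have := LinearMap.congr_fun h (1 : Λ)
      exact (one_smul Λ m).symm.trans (this.trans (one_smul Λ m'))
    refine ⟨⟨J, ⟨fun {X Y} g f _ => ?_⟩, ObjectProperty.homMk (ModuleCat.ofHom ι),
      (isFinMod k Λ).ι.mono_of_mono_map ((ModuleCat.mono_iff_injective _).2 hι)⟩⟩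
    let g' : X.obj →ₗ[k] M.obj :=
      { toFun x := (g.hom.hom x : Coinduced k Λ M.obj) 1
        map_add' x y := by rw [map_add]; rfl
        map_smul' c x := by
          rw [← algebraMap_smul Λ c x, map_smul]
          refine (congrArg (g.hom.hom x : Coinduced k Λ M.obj) ?_).trans
            (LinearMap.map_smul (show Λ →ₗ[k] M.obj from g.hom.hom x) c 1)
          exact (one_mul _).trans (Algebra.algebraMap_eq_smul_one c) }
    obtain ⟨r, hr⟩ := (f.hom.hom.restrictScalars k).exists_leftInverse_of_injective
      (LinearMap.ker_eq_bot.2 (finMod_injective f))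
    let h : Y.obj →ₗ[Λ] Coinduced k Λ M.obj :=
      { toFun y := (g' ∘ₗ r) ∘ₗ ((LinearMap.toSpanSingleton Λ Y.obj y).restrictScalars k)
        map_add' y y' := LinearMap.ext fun x =>
          (congrArg (g' ∘ₗ r) (smul_add x y y')).trans (map_add _ _ _)
        map_smul' a y := LinearMap.ext fun x => congrArg (g' ∘ₗ r) (mul_smul x a y).symm }
    refine ⟨ObjectProperty.homMk (ModuleCat.ofHom h), ObjectProperty.hom_ext _ ?_⟩
    ext x
    refine LinearMap.ext fun a => ?_
    change g' (r (a • f.hom.hom x)) = (g.hom.hom x : Coinduced k Λ M.obj) a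
    rw [← map_smul]
    refine (congrArg g' (LinearMap.congr_fun hr (a • x))).trans ?_
    change (g.hom.hom (a • x) : Coinduced k Λ M.obj) 1 = _
    rw [map_smul]
    exact congrArg (g.hom.hom x : Coinduced k Λ M.obj) (one_mul a)

lemma finMod_projective {X : FinMod k Λ} (h : Projective X.obj) : Projective X where
  factors g e _ := by
    have : Epi e.hom := (ModuleCat.epi_iff_surjective _).2 (finMod_surjective e)
    obtain ⟨q, hq⟩ := h.factors g.hom e.hom
    exact ⟨ObjectProperty.homMk q, ObjectProperty.hom_ext _ hq⟩

/-- Passes from the dimension in all `Λ`-modules to that in `mod Λ`: finite free covers are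
projective in both categories, and the inclusion is exact, so syzygies may be compared. -/
lemma finMod_hasProjectiveDimensionLT (n : ℕ) (X : FinMod k Λ)
    (h : HasProjectiveDimensionLT X.obj (n + 1)) : HasProjectiveDimensionLT X (n + 1) := by
  induction n generalizing X with
  | zero =>
    rw [← projective_iff_hasProjectiveDimensionLT_one] at h ⊢
    exact finMod_projective h
  | succ n ih =>
    have hX : Module.Finite Λ X.obj := X.property
    obtain ⟨m, f, hf⟩ := Module.Finite.exists_fin' Λ X.obj
    have hP : Projective (ModuleCat.of Λ (Fin m → Λ)) :=
      ModuleCat.projective_of_free (Pi.basisFun Λ (Fin m))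
    let P : FinMod k Λ := ⟨ModuleCat.of Λ (Fin m → Λ),
      (inferInstance : Module.Finite Λ (Fin m → Λ))⟩
    let p : P ⟶ X := ObjectProperty.homMk (ModuleCat.ofHom f)
    have : Epi p := (isFinMod k Λ).ι.epi_of_epi_map ((ModuleCat.epi_iff_surjective _).2 hf)
    have hS : (ShortComplex.mk _ _ (kernel.condition p)).ShortExact :=
      { exact := ShortComplex.exact_kernel p }
    have hι := (isFinMod k Λ).preservesKernels_ι
    have hι' := (isFinMod k Λ).preservesCokernels_ι
    have : PreservesFiniteLimits (isFinMod k Λ).ι :=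
      Functor.preservesFiniteLimits_of_preservesKernels _
    have : PreservesFiniteColimits (isFinMod k Λ).ι :=
      Functor.preservesFiniteColimits_of_preservesCokernels _
    have hS' := hS.map_of_exact (isFinMod k Λ).ι
    exact (hS.hasProjectiveDimensionLT_X₃_iff n (finMod_projective hP)).2
      (ih _ ((hS'.hasProjectiveDimensionLT_X₃_iff n hP).1 h))

instance (M N : FinMod k Λ) : FiniteDimensional k (M ⟶ N) := by
  let f : (M ⟶ N) →ₗ[k] (M.obj →ₗ[k] N.obj) :=
    { toFun g := g.hom.hom.restrictScalars k
      map_add' g g' := rfl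
      map_smul' c g := rfl }
  refine Module.Finite.of_injective f fun g g' h => ObjectProperty.hom_ext _ ?_
  ext x
  exact LinearMap.congr_fun h x

end FinMod

/-! ### Finite-dimensional morphism spaces are noetherian over endomorphism rings -/

section Noetherian

variable {k : Type t} [Field k] {C : Type u} [Category.{v} C] [Preadditive C] [Linear k C]

/-- Scalars act through endomorphisms `c • 𝟙 M`, so submodules are `k`-subspaces of a
finite-dimensional space. -/
lemma isNoetherian_hom (M N : C) [FiniteDimensional k (M ⟶ N)] :
    IsNoetherian (End M)ᵐᵒᵖ (M ⟶ N) := by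
  rw [isNoetherian_iff']
  let F (H : Submodule (End M)ᵐᵒᵖ (M ⟶ N)) : Submodule k (M ⟶ N) :=
    { H.toAddSubmonoid with
      smul_mem' c f hf := by
        have := H.smul_mem (MulOpposite.op (c • 𝟙 M : M ⟶ M)) hf
        change (c • 𝟙 M) ≫ f ∈ H at this
        rwa [Linear.smul_comp, Category.id_comp] at this }
  exact (OrderEmbedding.ofMapLEIff F fun _ _ => Iff.rfl).strictMono.wellFoundedGT

lemma isNoetherian_hom_op (M : C) (N : Cᵒᵖ) [FiniteDimensional k (N.unop ⟶ M)] :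
    IsNoetherian (End (op M))ᵐᵒᵖ (op M ⟶ N) := by
  rw [isNoetherian_iff']
  let F (H : Submodule (End (op M))ᵐᵒᵖ (op M ⟶ N)) : Submodule k (N.unop ⟶ M) :=
    { carrier := {f | f.op ∈ H}
      zero_mem' := H.zero_mem
      add_mem' hf hg := H.add_mem hf hg
      smul_mem' c f hf := by
        have := H.smul_mem (MulOpposite.op ((c • 𝟙 M : M ⟶ M).op : End (op M))) hf
        change (f ≫ (c • 𝟙 M)).op ∈ H at this
        rwa [Linear.comp_smul, Category.comp_id] at this }
  have hF (H H') : F H ≤ F H' ↔ H ≤ H' :=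
    ⟨fun h f hf => h (show f.unop ∈ F H from hf), fun h f hf => h hf⟩
  exact (OrderEmbedding.ofMapLEIff F hF).strictMono.wellFoundedGT

end Noetherian

/-! ### Additive generators -/

section AddGenerating

variable {C : Type u} [Category.{v} C] [Preadditive C] {M : C}

lemma IsAdditiveGenerator.isAddGenerating (h : IsAdditiveGenerator M) :
    IsAddGenerating fun _ : PUnit.{1} => M := fun X => by
  obtain ⟨n, Y, b, hY, ⟨hb⟩, ⟨r⟩⟩ := h X
  obtain rfl : Y = fun _ => M := funext hY
  refine ⟨n, fun _ => ⟨⟩, fun j => r.i ≫ b.π j, fun j => b.ι j ≫ r.r, ?_⟩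
  have := r.i ≫= IsBilimit.total hb =≫ r.r
  rw [Category.id_comp, r.retract] at this
  rw [← this, Preadditive.sum_comp, Preadditive.comp_sum]
  simp only [Category.assoc]

lemma IsAddGenerating.op {ι : Type t} {G : ι → C} (h : IsAddGenerating G) :
    IsAddGenerating fun i => op (G i) := fun X => by
  obtain ⟨n, i, u, v, huv⟩ := h X.unop
  refine ⟨n, i, fun r => (v r).op, fun r => (u r).op, Quiver.Hom.unop_inj ?_⟩
  rw [unop_sum]
  exact huv

end AddGenerating

/-! ### The Veronese algebra and the main theorem -/

/-- The Veronese algebra as a graded endomorphism ring. -/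
noncomputable def veroneseEndRing {C : Type u} [Category.{v} C] [Abelian C] [HasExt.{w} C] (M : C)
    (l : ℕ) : (Abelian.Ext.veronese C l).EndRing M (VeroneseAlgebra M l) where
  equiv := AddEquiv.refl _
  mul α β := DirectSum.of_mul_of (A := VeroneseComponent M l) α β
  one := rfl

theorem theorem3p14 {k : Type t} [Field k] {Λ : Type u} [Ring Λ] [Algebra k Λ]
    [FiniteDimensional k Λ] [HasDerivedCategory.{w} (FinMod k Λ)]
    (d l : ℕ) (hd : ringGlobalDim Λ = d) (hd2 : 2 ≤ d) (hl2 : 2 ≤ l) (hld : l ≤ d) :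
    (IsCoherentCat (VeroneseCat k Λ l) ∧
      leftGlobalDim (VeroneseCat k Λ l) ≤ ((3 * d - 1 : ℕ) : WithBot ℕ∞) ∧
      rightGlobalDim (VeroneseCat k Λ l) ≤ ((3 * d - 1 : ℕ) : WithBot ℕ∞)) ∧
    ∀ M : FinMod k Λ, IsAdditiveGenerator M →
      ringGlobalDim (VeroneseAlgebra M l) ≤ ((3 * d - 1 : ℕ) : WithBot ℕ∞) ∧
      ringGlobalDim (VeroneseAlgebra M l)ᵐᵒᵖ ≤ ((3 * d - 1 : ℕ) : WithBot ℕ∞) := by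
  -- Rank `n` stands for dimension at most `n + 1`, so dimension at most `d` means rank `N = d - 1`
  -- for all objects, and `3N + 2 = 3d - 1`.
  obtain ⟨N, rfl⟩ : ∃ N, d = N + 1 := ⟨d - 1, by lia⟩
  have hP (X : FinMod k Λ) : HasProjectiveDimensionLT X (N + 2) :=
    finMod_hasProjectiveDimensionLT _ X <| (projectiveDimension_le_iff _ _).1
      ((le_iSup (fun X : ModuleCat.{u} Λ => projectiveDimension X) X.obj).trans_eq hd)
  -- A uniform bound on projective dimensions makes `Ext` vanish in high degrees in both arguments,
  -- hence bounds the injective dimensions as well.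
  have hI (X : FinMod k Λ) : HasInjectiveDimensionLT X (N + 2) :=
    (hasInjectiveDimensionLT_iff X (N + 2)).2 fun i hi Y e =>
      e.eq_zero_of_hasProjectiveDimensionLT _ hi
  have h := Abelian.Ext.veronese_isResolving (C := FinMod k Λ) hl2
  have h' := Abelian.Ext.veronese_op_isResolving (C := FinMod k Λ) hl2
  have ρ := veroneseRealization (k := k) (Λ := Λ) (l := l) (by lia)
  rw [show 3 * (N + 1) - 1 = 3 * N + 2 by lia]
  refine ⟨⟨⟨Realization.hasWeakKernels h hI ρ,
      Realization.hasWeakKernels h' (fun X => hP X.unop) ρ.op⟩,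
    Realization.leftGlobalDim_le h hI ρ,
    Realization.leftGlobalDim_le h' (fun X => hP X.unop) ρ.op⟩, fun M hM => ⟨?_, ?_⟩⟩
  · exact (veroneseEndRing M l).ringGlobalDim_le h hM.isAddGenerating
      (fun Z => isNoetherian_hom (k := k) M Z) hI
  · exact (veroneseEndRing M l).op.ringGlobalDim_le h' hM.isAddGenerating.op
      (fun Z => isNoetherian_hom_op (k := k) M Z) fun X => hP X.unop
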